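/- Notation and definitions. Hilbert spaces are complex, with inner products linear in the second argument; $\otimes$ is the Hilbert-space tensor product and $\overline{\otimes}$ the von Neumann (ultraweak) tensor product; "normal" means ultraweakly continuous. Let $\mathfrak h$ and $\mathsf k$ be Hilbert spaces and let $\mathcal A$ be a von Neumann algebra acting on $\mathfrak h$. For an interval $J\subseteq\mathbb R_+$ let $\mathcal F_J$ be the Boson Fock space over $L^2(J;\mathsf k)$, with exponential vectors $\varepsilon(f)$ and vacuum vector $\Omega_J=\varepsilon(0)$, and put $\mathcal F=\mathcal F_{\mathbb R_+}$, $\Omega=\Omega_{\mathbb R_+}$, $\mathcal F_{t)}=\mathcal F_{[0,t)}$, $\mathcal F_{[t}=\mathcal F_{[t,\infty)}$, $\Omega_{[t}=\Omega_{[t,\infty)}$, $\mathcal N_J=B(\mathcal F_J)$ (with the same abbreviations), and identify $\mathcal F=\mathcal F_{t)}\otimes\mathcal F_{[t}$ through $\varepsilon(f)=\varepsilon(f|_{[0,t)})\otimes\varepsilon(f|_{[t,\infty)})$. Let $S_t:\mathcal F\to\mathcal F_{[t}$ be the unitary operator with $S_t\varepsilon(f)=\varepsilon(f(\cdot-t))$,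 let $\sigma_t(T)=(1\otimes S_t)T(1\otimes S_t)^*$ for $T\in\mathcal A\overline\otimes\mathcal N$, let $P_t=1_{\mathfrak h\otimes\mathcal F_{t)}}\otimes|\Omega_{[t}\rangle\langle\Omega_{[t}|$, and let $\mathbb E=\mathrm{id}_{\mathcal A}\,\overline\otimes\,\omega_\Omega:\mathcal A\overline\otimes\mathcal N\to\mathcal A$ be the vacuum expectation, where $\omega_\Omega(T)=\langle\Omega,T\Omega\rangle$. A vacuum-adapted quantum stochastic flow on $\mathcal A$ is a family $j=(j_t)_{t\ge0}$ of normal completely bounded maps $j_t:\mathcal A\to\mathcal A\overline\otimes\mathcal N$ such that, for all $a\in\mathcal A$ and $s,t\ge0$: (i) $j_0(a)=a\otimes|\Omega\rangle\langle\Omega|$; (ii) $j_t(a)=j_{t)}(a)\otimes|\Omega_{[t}\rangle\langle\Omega_{[t}|$ with $j_{t)}(a)\in\mathcal A\overline\otimes\mathcal N_{t)}$; (iii) $j_{s+t}=J_s\circ j_t$, where $J_s=(j_{s)}\,\overline\otimes\,\mathrm{id}_{\mathcal N_{[s}})\circ\sigma_s$; (iv) $r\mapsto j_r(a)$ is ultraweakly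 continuous; and each $j_{t)}$ is a unital $*$-homomorphism. A multiplier for $j$ is a family $M=(M_t)_{t\ge0}$ in $\mathcal A\overline\otimes\mathcal N$ such that, for all $s,t\ge0$: (i) $M_0=1$; (ii) $M_tP_t=P_tM_t$; (iii) $M_{s+t}=J_s(M_t)M_s$; (iv) $r\mapsto M_r$ is strongly continuous. Theorem 2.6. Let $j$ be a vacuum-adapted quantum stochastic flow on $\mathcal A$, let $M$ and $N$ be multipliers for $j$, and set $$\mathcal P_t(a)=\mathbb E[M_t^*\,j_t(a)\,N_t]\qquad(t\ge0,\ a\in\mathcal A).$$ Then each $\mathcal P_t$ is a normal completely bounded linear map from $\mathcal A$ to $\mathcal A$, the map $t\mapsto\mathcal P_t(a)$ is ultraweakly continuous for each $a\in\mathcal A$, and $(\mathcal P_t)_{t\ge0}$ is a semigroup: $\mathcal P_0=\mathrm{id}_{\mathcal A}$ and $\mathcal P_{s+t}=\mathcal P_s\circ\mathcal P_t$ for all $s,t\ge0$. If $\|M_t\|\le1$ and $\|N_t\|\le1$ for all $t\ge0$, then every $\mathcal P_t$ is completely contractive. If $M=N$, then every $\mathcal P_t$ is completely positive. -/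

import Mathlib

open MeasureTheory
open scoped NNReal TensorProduct InnerProductSpace

set_option linter.unusedSectionVars false

noncomputable section

namespace QStoch

/-! ### Hilbert-space tensor products -/

section Gram

variable {ι E F : Type*} [NormedAddCommGroup E] [InnerProductSpace ℂ E]
  [NormedAddCommGroup F] [InnerProductSpace ℂ F]

/-- A family of vectors is total if its linear span is dense. -/
def IsTotal (x : ι → E) : Prop := DenseRange (Finsupp.linearCombination ℂ x)

theorem norm_linearCombination_eq {x : ι → E} {y : ι → F}
    (h : ∀ i j, inner ℂ (x i) (x j) = inner ℂ (y i) (y j)) (c : ι →₀ ℂ) :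
    ‖Finsupp.linearCombination ℂ y c‖ = ‖Finsupp.linearCombination ℂ x c‖ := by
  have key : inner ℂ (Finsupp.linearCombination ℂ y c) (Finsupp.linearCombination ℂ y c) =
      inner ℂ (Finsupp.linearCombination ℂ x c) (Finsupp.linearCombination ℂ x c) := by
    simp only [Finsupp.linearCombination_apply, Finsupp.sum, sum_inner, inner_sum,
      inner_smul_left, inner_smul_right, h]
  rw [inner_self_eq_norm_sq_to_K, inner_self_eq_norm_sq_to_K] at key
  have : ‖Finsupp.linearCombination ℂ y c‖ ^ 2 = ‖Finsupp.linearCombination ℂ x c‖ ^ 2 := by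
    exact_mod_cast key
  exact (sq_eq_sq₀ (norm_nonneg _) (norm_nonneg _)).1 this

/-- The unitary `x i ↦ y i` between Hilbert spaces, where `x` and `y` are total families
with the same Gram matrix. -/
def gramUnitary [CompleteSpace E] [CompleteSpace F] (x : ι → E) (y : ι → F)
    (h : ∀ i j, inner ℂ (x i) (x j) = inner ℂ (y i) (y j)) (hx : IsTotal x) (hy : IsTotal y) :
    E ≃ₗᵢ[ℂ] F :=
  (LinearEquiv.refl ℂ (ι →₀ ℂ)).extendOfIsometry (Finsupp.linearCombination ℂ x)
    (Finsupp.linearCombination ℂ y) hx hy (norm_linearCombination_eq h)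

theorem gramUnitary_apply [CompleteSpace E] [CompleteSpace F] (x : ι → E) (y : ι → F)
    (h : ∀ i j, inner ℂ (x i) (x j) = inner ℂ (y i) (y j)) (hx : IsTotal x) (hy : IsTotal y)
    (i : ι) : gramUnitary x y h hx hy (x i) = y i := by
  have := LinearEquiv.extendOfIsometry_eq (LinearEquiv.refl ℂ (ι →₀ ℂ))
    (Finsupp.linearCombination ℂ x) (Finsupp.linearCombination ℂ y) hx hy
    (norm_linearCombination_eq h) (Finsupp.single i 1)
  simpa [gramUnitary] using this

theorem isTotal_iff {x : ι → E} :
    IsTotal x ↔ (Submodule.span ℂ (Set.range x)).topologicalClosure = ⊤ := by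
  rw [IsTotal, ← Submodule.dense_iff_topologicalClosure_eq_top, DenseRange,
    ← Finsupp.range_linearCombination, LinearMap.coe_range]

theorem isTotal_of_forall [CompleteSpace E] {x : ι → E}
    (h : ∀ v : E, (∀ i, inner ℂ (x i) v = 0) → v = 0) : IsTotal x := by
  rw [isTotal_iff, Submodule.topologicalClosure_eq_top_iff, Submodule.eq_bot_iff]
  intro v hv
  refine h v fun i => ?_
  exact hv _ (Submodule.subset_span ⟨i, rfl⟩)

theorem IsTotal.eq_zero {x : ι → E} (hx : IsTotal x) {v : E}
    (h : ∀ i, inner ℂ (x i) v = 0) : v = 0 := by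
  rw [isTotal_iff, ← Submodule.dense_iff_topologicalClosure_eq_top] at hx
  refine hx.eq_zero_of_inner_right ℂ fun w hw => ?_
  induction hw using Submodule.span_induction with
  | mem w hw => obtain ⟨i, rfl⟩ := hw; exact h i
  | zero => simp
  | add a b _ _ ha hb => rw [inner_add_left, ha, hb, add_zero]
  | smul c a _ ha => rw [inner_smul_left, ha, mul_zero]

theorem IsTotal.clm_ext {x : ι → E} (hx : IsTotal x) {S T : E →L[ℂ] F}
    (h : ∀ i, S (x i) = T (x i)) : S = T := by
  rw [isTotal_iff, ← Submodule.dense_iff_topologicalClosure_eq_top] at hx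
  exact ContinuousLinearMap.ext_on hx (by rintro _ ⟨i, rfl⟩; exact h i)

end Gram

universe u v w

section HTensor

variable (H : Type u) (K : Type v) [NormedAddCommGroup H] [InnerProductSpace ℂ H]
  [NormedAddCommGroup K] [InnerProductSpace ℂ K]

/-- The Hilbert-space tensor product `H ⊗ K`: the completion of the algebraic one. -/
def HTensor : Type (max u v) := UniformSpace.Completion (H ⊗[ℂ] K)

instance : NormedAddCommGroup (HTensor H K) :=
  inferInstanceAs (NormedAddCommGroup (UniformSpace.Completion (H ⊗[ℂ] K)))

instance : InnerProductSpace ℂ (HTensor H K) :=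
  inferInstanceAs (InnerProductSpace ℂ (UniformSpace.Completion (H ⊗[ℂ] K)))

instance : CompleteSpace (HTensor H K) :=
  inferInstanceAs (CompleteSpace (UniformSpace.Completion (H ⊗[ℂ] K)))

/-- The canonical embedding of the algebraic tensor product. -/
def algEmb : H ⊗[ℂ] K →L[ℂ] HTensor H K := UniformSpace.Completion.toComplL

variable {H K}

theorem algEmb_denseRange : DenseRange (algEmb H K) := UniformSpace.Completion.denseRange_coe

theorem inner_algEmb (s t : H ⊗[ℂ] K) : inner ℂ (algEmb H K s) (algEmb H K t) = inner ℂ s t :=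
  UniformSpace.Completion.inner_coe s t

theorem norm_algEmb (s : H ⊗[ℂ] K) : ‖algEmb H K s‖ = ‖s‖ := UniformSpace.Completion.norm_coe s

theorem algEmb_isUniformInducing : IsUniformInducing (algEmb H K) :=
  UniformSpace.Completion.isUniformInducing_coe _

/-- The elementary tensor `u ⊗ x`. -/
def htmul (u : H) (x : K) : HTensor H K := algEmb H K (u ⊗ₜ x)

theorem inner_htmul (u u' : H) (x x' : K) :
    inner ℂ (htmul u x) (htmul u' x') = inner ℂ u u' * inner ℂ x x' := by
  rw [htmul, htmul, inner_algEmb, TensorProduct.inner_tmul]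

theorem norm_htmul (u : H) (x : K) : ‖htmul u x‖ = ‖u‖ * ‖x‖ := by
  rw [htmul, norm_algEmb, TensorProduct.norm_tmul]

/-- `u ↦ u ⊗ x` as a bounded operator, `E_x` in the `E` notation. -/
def ket (H : Type u) [NormedAddCommGroup H] [InnerProductSpace ℂ H] (x : K) : H →L[ℂ] HTensor H K :=
  (algEmb H K).comp ((TensorProduct.mkL ℂ H K).flip x)

@[simp] theorem ket_apply (x : K) (u : H) : ket H x u = htmul u x := rfl

/-- `x ↦ u ⊗ x` as a bounded operator. -/
def leftKet (K : Type v) [NormedAddCommGroup K] [InnerProductSpace ℂ K] (u : H) :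
    K →L[ℂ] HTensor H K :=
  (algEmb H K).comp (TensorProduct.mkL ℂ H K u)

@[simp] theorem leftKet_apply (x : K) (u : H) : leftKet K u x = htmul u x := rfl

theorem ket_add (x y : K) : ket H (x + y) = ket H x + ket H y := by
  simp [ket]

theorem ket_smul (c : ℂ) (x : K) : ket H (c • x) = c • ket H x := by
  simp [ket]

theorem norm_ket_le (x : K) : ‖ket H x‖ ≤ ‖x‖ :=
  ContinuousLinearMap.opNorm_le_bound _ (norm_nonneg _) fun u => by
    rw [ket_apply, norm_htmul, mul_comm]

theorem IsTotal.inner_map_eq_zero {ι E F : Type*} [NormedAddCommGroup E] [InnerProductSpace ℂ E]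
    [NormedAddCommGroup F] [InnerProductSpace ℂ F] {x : ι → E} (hx : IsTotal x) (L : E →L[ℂ] F)
    (v : F) (h : ∀ i, inner ℂ (L (x i)) v = 0) (b : E) : inner ℂ (L b) v = 0 := by
  have : (innerSL ℂ v).comp L = 0 := hx.clm_ext fun i => by
    simpa using inner_eq_zero_symm.1 (h i)
  exact inner_eq_zero_symm.1 (by simpa using congrArg (fun T => T b) this)

theorem htmul_total {ι κ : Type*} {x : ι → H} {y : κ → K} (hx : IsTotal x) (hy : IsTotal y) :
    IsTotal fun p : ι × κ => htmul (x p.1) (y p.2) := by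
  refine isTotal_of_forall fun v hv => ?_
  have h1 : ∀ (i : ι) (b : K), inner ℂ (htmul (x i) b) v = 0 := fun i =>
    hy.inner_map_eq_zero (leftKet K (x i)) v fun j => hv (i, j)
  have h2 : ∀ (a : H) (b : K), inner ℂ (htmul a b) v = 0 := fun a b =>
    hx.inner_map_eq_zero (ket H b) v (fun i => h1 i b) a
  have h3 : ∀ s : H ⊗[ℂ] K, inner ℂ (algEmb H K s) v = 0 := by
    intro s
    induction s using TensorProduct.induction_on with
    | zero => simp
    | tmul a b => exact h2 a b
    | add s t hs ht => rw [map_add, inner_add_left, hs, ht, add_zero]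
  have hd : Dense (LinearMap.range (algEmb H K).toLinearMap : Set (HTensor H K)) := by
    rw [LinearMap.coe_range]; exact algEmb_denseRange
  refine hd.eq_zero_of_inner_right ℂ ?_
  rintro _ ⟨s, rfl⟩
  exact h3 s

theorem isTotal_id {E : Type*} [NormedAddCommGroup E] [InnerProductSpace ℂ E] :
    IsTotal (id : E → E) :=
  Function.Surjective.denseRange fun x => ⟨Finsupp.single x 1, by simp⟩

theorem htmul_total' : IsTotal fun p : H × K => htmul p.1 p.2 :=
  htmul_total (x := (id : H → H)) (y := (id : K → K)) isTotal_id isTotal_id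

theorem htensor_ext {F : Type*} [NormedAddCommGroup F] [InnerProductSpace ℂ F]
    {S T : HTensor H K →L[ℂ] F} (h : ∀ u x, S (htmul u x) = T (htmul u x)) : S = T :=
  htmul_total'.clm_ext fun p => h p.1 p.2

section opTensor

variable {H' : Type*} {K' : Type*} [NormedAddCommGroup H'] [InnerProductSpace ℂ H']
  [NormedAddCommGroup K'] [InnerProductSpace ℂ K']

/-- The tensor product `S ⊗ T` of bounded operators, with `(S ⊗ T)(u ⊗ x) = S u ⊗ T x`. -/
def opTensor (S : H →L[ℂ] H') (T : K →L[ℂ] K') : HTensor H K →L[ℂ] HTensor H' K' :=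
  ((algEmb H' K').comp (TensorProduct.mapL S T)).extend (algEmb H K)

@[simp] theorem opTensor_htmul (S : H →L[ℂ] H') (T : K →L[ℂ] K') (u : H) (x : K) :
    opTensor S T (htmul u x) = htmul (S u) (T x) := by
  rw [opTensor, htmul, ContinuousLinearMap.extend_eq _ algEmb_denseRange algEmb_isUniformInducing]
  rfl

theorem opTensor_comp {H'' K'' : Type*} [NormedAddCommGroup H''] [InnerProductSpace ℂ H'']
    [NormedAddCommGroup K''] [InnerProductSpace ℂ K''] (S' : H' →L[ℂ] H'') (T' : K' →L[ℂ] K'')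
    (S : H →L[ℂ] H') (T : K →L[ℂ] K') :
    (opTensor S' T').comp (opTensor S T) = opTensor (S'.comp S) (T'.comp T) :=
  htensor_ext fun u x => by simp

theorem opTensor_id :
    opTensor (ContinuousLinearMap.id ℂ H) (ContinuousLinearMap.id ℂ K) =
      ContinuousLinearMap.id ℂ _ :=
  htensor_ext fun u x => by simp

theorem opTensor_adjoint [CompleteSpace H] [CompleteSpace K] [CompleteSpace H'] [CompleteSpace K']
    (S : H →L[ℂ] H') (T : K →L[ℂ] K') :
    ContinuousLinearMap.adjoint (opTensor S T) =
      opTensor (ContinuousLinearMap.adjoint S) (ContinuousLinearMap.adjoint T) := by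
  refine htensor_ext fun u x => ?_
  rw [← sub_eq_zero]
  refine htmul_total'.eq_zero fun p => ?_
  rw [inner_sub_right, ContinuousLinearMap.adjoint_inner_right, opTensor_htmul, opTensor_htmul,
    inner_htmul, inner_htmul, ContinuousLinearMap.adjoint_inner_right,
    ContinuousLinearMap.adjoint_inner_right, sub_self]

end opTensor

end HTensor

/-! ### Von Neumann algebras -/

section VN

variable {H : Type u} {K : Type v} [NormedAddCommGroup H] [InnerProductSpace ℂ H]
  [NormedAddCommGroup K] [InnerProductSpace ℂ K] [CompleteSpace H] [CompleteSpace K]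

instance : SMulMemClass (VonNeumannAlgebra H) ℂ (H →L[ℂ] H) where
  smul_mem {s} c _ ha := s.toStarSubalgebra.smul_mem ha c

/-- The inclusion of a von Neumann algebra in the algebra of all bounded operators. -/
def incl (A : VonNeumannAlgebra H) : A →ₗ[ℂ] (H →L[ℂ] H) where
  toFun a := a
  map_add' _ _ := rfl
  map_smul' _ _ := rfl

@[simp] theorem incl_apply (A : VonNeumannAlgebra H) (a : A) : incl A a = (a : H →L[ℂ] H) := rfl

/-- The von Neumann algebra `S''` generated by a set of operators (`S` is made closed under
adjoints first). -/
def vnGenerated (S : Set (H →L[ℂ] H)) : VonNeumannAlgebra H where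
  toStarSubalgebra :=
    StarSubalgebra.centralizer ℂ (StarSubalgebra.centralizer ℂ S : Set (H →L[ℂ] H))
  centralizer_centralizer' := by
    change Set.centralizer (Set.centralizer
      (StarSubalgebra.centralizer ℂ (StarSubalgebra.centralizer ℂ S : Set (H →L[ℂ] H)) :
        Set (H →L[ℂ] H))) =
      (StarSubalgebra.centralizer ℂ (StarSubalgebra.centralizer ℂ S : Set (H →L[ℂ] H)) :
        Set (H →L[ℂ] H))
    rw [StarSubalgebra.coe_centralizer, Set.centralizer_centralizer_centralizer]

/-- The von Neumann algebra `B(H)` of all bounded operators. -/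
def boundedOps (H : Type u) [NormedAddCommGroup H] [InnerProductSpace ℂ H] [CompleteSpace H] :
    VonNeumannAlgebra H where
  toStarSubalgebra := ⊤
  centralizer_centralizer' := by
    refine Set.eq_univ_of_forall fun x => ?_
    rw [Set.mem_centralizer_iff]
    intro c hc
    exact ((Set.mem_centralizer_iff.1 hc) x trivial).symm

theorem mem_boundedOps (T : H →L[ℂ] H) : T ∈ boundedOps H := trivial

/-- The von Neumann tensor product of `A` and `B`, generated by the operators `a ⊗ b`. -/
def vnTensor (A : VonNeumannAlgebra H) (B : VonNeumannAlgebra K) :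
    VonNeumannAlgebra (HTensor H K) :=
  vnGenerated {T | ∃ a ∈ A, ∃ b ∈ B, T = opTensor a b}

theorem mem_vnTensor_iff (A : VonNeumannAlgebra H) (B : VonNeumannAlgebra K)
    (T : HTensor H K →L[ℂ] HTensor H K) :
    T ∈ vnTensor A B ↔ ∀ c : HTensor H K →L[ℂ] HTensor H K,
      (∀ a ∈ A, ∀ b ∈ B, opTensor a b * c = c * opTensor a b) → c * T = T * c := by
  change T ∈ StarSubalgebra.centralizer ℂ (StarSubalgebra.centralizer ℂ
    {T | ∃ a ∈ A, ∃ b ∈ B, T = opTensor a b} : Set (HTensor H K →L[ℂ] HTensor H K)) ↔ _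
  have hc : ∀ c : HTensor H K →L[ℂ] HTensor H K,
      c ∈ StarSubalgebra.centralizer ℂ {T | ∃ a ∈ A, ∃ b ∈ B, T = opTensor a b} ↔
      ∀ a ∈ A, ∀ b ∈ B, opTensor a b * c = c * opTensor a b := by
    intro c
    rw [StarSubalgebra.mem_centralizer_iff]
    constructor
    · intro h a ha b hb
      exact (h _ ⟨a, ha, b, hb, rfl⟩).1
    · rintro h _ ⟨a, ha, b, hb, rfl⟩
      refine ⟨h a ha b hb, ?_⟩
      rw [ContinuousLinearMap.star_eq_adjoint, opTensor_adjoint]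
      exact h _ (star_mem ha) _ (star_mem hb)
  rw [StarSubalgebra.mem_centralizer_iff]
  constructor
  · intro h c h'
    exact (h c ((hc c).2 h')).1
  · intro h c h'
    exact ⟨h c ((hc c).1 h'), h _ ((hc _).1 (star_mem h'))⟩

theorem opTensor_mem (A : VonNeumannAlgebra H) (B : VonNeumannAlgebra K) {a : H →L[ℂ] H}
    {b : K →L[ℂ] K} (ha : a ∈ A) (hb : b ∈ B) : opTensor a b ∈ vnTensor A B :=
  (mem_vnTensor_iff A B _).2 fun _ h => (h a ha b hb).symm

/-- The slice `E^x T E_y` of an operator on `H ⊗ K`, so that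
`⟪u, (E^x T E_y) v⟫ = ⟪u ⊗ x, T (v ⊗ y)⟫`. -/
def slice (x y : K) (T : HTensor H K →L[ℂ] HTensor H K) : H →L[ℂ] H :=
  (ContinuousLinearMap.adjoint (ket H x)).comp (T.comp (ket H y))

theorem inner_slice (x y : K) (T : HTensor H K →L[ℂ] HTensor H K) (u v : H) :
    inner ℂ u (slice x y T v) = inner ℂ (htmul u x) (T (htmul v y)) := by
  simp [slice, ContinuousLinearMap.adjoint_inner_right]

theorem slice_mem (A : VonNeumannAlgebra H) (B : VonNeumannAlgebra K) (x y : K)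
    {T : HTensor H K →L[ℂ] HTensor H K} (hT : T ∈ vnTensor A B) : slice x y T ∈ A := by
  rw [← A.commutant_commutant, VonNeumannAlgebra.mem_commutant_iff]
  intro c hc
  have hc' := VonNeumannAlgebra.mem_commutant_iff.1 hc
  have h1 : opTensor c (ContinuousLinearMap.id ℂ K) * T =
      T * opTensor c (ContinuousLinearMap.id ℂ K) := by
    refine (mem_vnTensor_iff A B T).1 hT _ fun a ha b _ => ?_
    rw [ContinuousLinearMap.mul_def, ContinuousLinearMap.mul_def, opTensor_comp, opTensor_comp,
      ← ContinuousLinearMap.mul_def, ← ContinuousLinearMap.mul_def, hc' a ha]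
    rfl
  refine ContinuousLinearMap.ext fun v => ext_inner_left ℂ fun u => ?_
  have h2 := congrArg (fun S => inner ℂ (htmul u x) (S (htmul v y))) h1
  simp only [ContinuousLinearMap.mul_def, ContinuousLinearMap.comp_apply, opTensor_htmul,
    ContinuousLinearMap.id_apply] at h2 ⊢
  rw [inner_slice, ← h2, ← ContinuousLinearMap.adjoint_inner_left, inner_slice,
    ← ContinuousLinearMap.adjoint_inner_left (opTensor c _), opTensor_adjoint, opTensor_htmul,
    ← ContinuousLinearMap.star_eq_adjoint (ContinuousLinearMap.id ℂ K)]
  have : star (ContinuousLinearMap.id ℂ K) = ContinuousLinearMap.id ℂ K := star_one _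
  rw [this, ContinuousLinearMap.id_apply]

/-- The slice map on a tensor product algebra, with values in the first algebra. -/
def sliceMap (A : VonNeumannAlgebra H) (B : VonNeumannAlgebra K) (x y : K) :
    vnTensor A B →ₗ[ℂ] A where
  toFun T := ⟨slice x y T, slice_mem A B x y T.2⟩
  map_add' S T := Subtype.ext <| by simp [slice]
  map_smul' c T := Subtype.ext <| by simp [slice]

/-- The ultraweak topology on `B(H)`: the weakest topology for which all the functionals
`T ↦ ∑ n, ⟪x n, T (y n)⟫`, with `x` and `y` square-summable sequences in `H`, are continuous. -/
@[reducible] def ultraweak (H : Type u) [NormedAddCommGroup H] [InnerProductSpace ℂ H] :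
    TopologicalSpace (H →L[ℂ] H) :=
  TopologicalSpace.induced
    (fun T (p : lp (fun _ : ℕ => H) 2 × lp (fun _ : ℕ => H) 2) =>
      ∑' n, inner ℂ (p.1 n) (T (p.2 n))) inferInstance

/-- A linear map on a von Neumann algebra is normal if it is ultraweakly continuous. -/
def IsNormal {A : VonNeumannAlgebra H} (φ : A →ₗ[ℂ] (K →L[ℂ] K)) : Prop :=
  @Continuous A (K →L[ℂ] K) (TopologicalSpace.induced Subtype.val (ultraweak H)) (ultraweak K) φ

/-- The operator on `H ⊕ ⋯ ⊕ H` with operator-matrix `a`. -/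
def matOp {H : Type u} [NormedAddCommGroup H] [InnerProductSpace ℂ H] {n : ℕ}
    (a : Fin n → Fin n → (H →L[ℂ] H)) :
    PiLp 2 (fun _ : Fin n => H) →L[ℂ] PiLp 2 (fun _ : Fin n => H) :=
  (PiLp.continuousLinearEquiv 2 ℂ (fun _ : Fin n => H)).symm.toContinuousLinearMap.comp
    (ContinuousLinearMap.pi fun i => ∑ j, (a i j).comp (PiLp.proj 2 (fun _ : Fin n => H) j))

theorem matOp_apply {n : ℕ} (a : Fin n → Fin n → (H →L[ℂ] H))
    (f : PiLp 2 (fun _ : Fin n => H)) (i : Fin n) : matOp a f i = ∑ j, a i j (f j) := by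
  simp [matOp]

theorem inner_matOp {n : ℕ} (a : Fin n → Fin n → (H →L[ℂ] H))
    (f g : PiLp 2 (fun _ : Fin n => H)) :
    inner ℂ f (matOp a g) = ∑ i, ∑ j, inner ℂ (f i) (a i j (g j)) := by
  simp [PiLp.inner_apply, matOp_apply, inner_sum]

/-- All the matrix lifts `[a i j] ↦ [φ (a i j)]` of `φ` have norm at most `C`; that is, the
completely bounded norm of `φ` is at most `C`. -/
def CBNormLE {A : VonNeumannAlgebra H} (φ : A →ₗ[ℂ] (K →L[ℂ] K)) (C : ℝ) : Prop :=
  ∀ (n : ℕ) (a : Fin n → Fin n → A),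
    ‖matOp (fun i j => φ (a i j))‖ ≤ C * ‖matOp (fun i j => (a i j : H →L[ℂ] H))‖

/-- Complete boundedness of a linear map on a von Neumann algebra. -/
def IsCompletelyBounded {A : VonNeumannAlgebra H} (φ : A →ₗ[ℂ] (K →L[ℂ] K)) : Prop :=
  ∃ C : ℝ, CBNormLE φ C

/-- Complete contractivity of a linear map on a von Neumann algebra. -/
def IsCompletelyContractive {A : VonNeumannAlgebra H} (φ : A →ₗ[ℂ] (K →L[ℂ] K)) : Prop :=
  CBNormLE φ 1

/-- Complete positivity: all the matrix lifts of `φ` preserve positivity. -/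
def IsCompletelyPositive {A : VonNeumannAlgebra H} (φ : A →ₗ[ℂ] (K →L[ℂ] K)) : Prop :=
  ∀ (n : ℕ) (a : Fin n → Fin n → A),
    (matOp (fun i j => (a i j : H →L[ℂ] H))).IsPositive →
      (matOp (fun i j => φ (a i j))).IsPositive

theorem norm_le_of_inner {E F : Type*} [NormedAddCommGroup E] [InnerProductSpace ℂ E]
    [NormedAddCommGroup F] [InnerProductSpace ℂ F] (S : E →L[ℂ] F) {M : ℝ} (hM : 0 ≤ M)
    (h : ∀ f g, ‖inner ℂ f (S g)‖ ≤ M * ‖f‖ * ‖g‖) : ‖S‖ ≤ M := by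
  refine S.opNorm_le_bound hM fun g => ?_
  have := h (S g) g
  rw [inner_self_eq_norm_sq_to_K] at this
  simp only [norm_pow, Complex.coe_algebraMap, Complex.norm_real, norm_norm] at this
  rcases (norm_nonneg (S g)).eq_or_lt with h0 | h0
  · rw [← h0]; positivity
  · nlinarith

/-- Compression `a ↦ V* φ(a) V` of a map. -/
def compress {L : Type w} [NormedAddCommGroup L] [InnerProductSpace ℂ L] [CompleteSpace L]
    {A : VonNeumannAlgebra H} (V : L →L[ℂ] K) (φ : A →ₗ[ℂ] (K →L[ℂ] K)) :
    A →ₗ[ℂ] (L →L[ℂ] L) where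
  toFun a := (ContinuousLinearMap.adjoint V).comp ((φ a).comp V)
  map_add' a b := by simp
  map_smul' c a := by simp

theorem IsCompletelyBounded.compress {L : Type w} [NormedAddCommGroup L] [InnerProductSpace ℂ L]
    [CompleteSpace L] {A : VonNeumannAlgebra H} (V : L →L[ℂ] K) {φ : A →ₗ[ℂ] (K →L[ℂ] K)}
    (hφ : IsCompletelyBounded φ) : IsCompletelyBounded (compress V φ) := by
  obtain ⟨C, hC⟩ := hφ
  refine ⟨‖V‖ * ‖V‖ * C, fun n a => ?_⟩
  set X := matOp (fun i j => φ (a i j)) with hX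
  have hV : ∀ f : PiLp 2 (fun _ : Fin n => L),
      ‖(WithLp.toLp 2 fun i => V (f i) : PiLp 2 (fun _ : Fin n => K))‖ ≤ ‖V‖ * ‖f‖ := by
    intro f
    refine (sq_le_sq₀ (norm_nonneg _) (by positivity)).1 ?_
    rw [PiLp.norm_sq_eq_of_L2, mul_pow, PiLp.norm_sq_eq_of_L2, Finset.mul_sum]
    refine Finset.sum_le_sum fun i _ => ?_
    rw [← mul_pow]
    exact pow_le_pow_left₀ (norm_nonneg _) (V.le_opNorm _) 2
  have h1 : ‖matOp (fun i j => QStoch.compress V φ (a i j))‖ ≤ ‖V‖ * ‖V‖ * ‖X‖ := by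
    refine norm_le_of_inner _ (by positivity) fun f g => ?_
    have : inner ℂ f (matOp (fun i j => QStoch.compress V φ (a i j)) g) =
        inner ℂ (WithLp.toLp 2 fun i => V (f i) : PiLp 2 (fun _ : Fin n => K))
          (X (WithLp.toLp 2 fun i => V (g i))) := by
      rw [inner_matOp, hX, inner_matOp]
      simp [QStoch.compress, ContinuousLinearMap.adjoint_inner_right]
    rw [this]
    calc _ ≤ ‖(WithLp.toLp 2 fun i => V (f i) : PiLp 2 (fun _ : Fin n => K))‖ *
          ‖X (WithLp.toLp 2 fun i => V (g i))‖ := norm_inner_le_norm _ _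
      _ ≤ (‖V‖ * ‖f‖) * (‖X‖ * (‖V‖ * ‖g‖)) := by
          gcongr
          · exact hV f
          · exact (X.le_opNorm _).trans (by gcongr; exact hV g)
      _ = _ := by ring
  calc _ ≤ ‖V‖ * ‖V‖ * ‖X‖ := h1
    _ ≤ ‖V‖ * ‖V‖ * (C * _) := by gcongr; exact hC n a
    _ = _ := by ring

/-! ### Ampliation of completely bounded maps -/

theorem exists_op_of_form {ι κ E F : Type*} [NormedAddCommGroup E] [InnerProductSpace ℂ E]
    [NormedAddCommGroup F] [InnerProductSpace ℂ F] [CompleteSpace E]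
    {x : ι → E} {y : κ → F} (hx : IsTotal x) (hy : IsTotal y) (β : ι → κ → ℂ) {C : ℝ} (hC : 0 ≤ C)
    (h : ∀ (ξ : ι →₀ ℂ) (η : κ →₀ ℂ),
      ‖∑ i ∈ ξ.support, ∑ j ∈ η.support, starRingEnd ℂ (ξ i) * η j * β i j‖ ≤
        C * ‖Finsupp.linearCombination ℂ x ξ‖ * ‖Finsupp.linearCombination ℂ y η‖) :
    ∃ R : F →L[ℂ] E, ∀ i j, inner ℂ (x i) (R (y j)) = β i j := by
  let γ : (κ →₀ ℂ) → ι → ℂ := fun η i => ∑ j ∈ η.support, η j * β i j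
  have γ_eq : ∀ η i, γ η i = Finsupp.linearCombination ℂ (β i) η := by
    intro η i; simp [γ, Finsupp.linearCombination_apply, Finsupp.sum]
  let f : (κ →₀ ℂ) → (ι →₀ ℂ) →ₗ[ℂ] ℂ := fun η =>
    Finsupp.linearCombination ℂ (fun i => starRingEnd ℂ (γ η i))
  have hf : ∀ η ξ, ‖f η ξ‖ ≤ (C * ‖Finsupp.linearCombination ℂ y η‖) *
      ‖Finsupp.linearCombination ℂ x ξ‖ := by
    intro η ξ
    have e : f η ξ = starRingEnd ℂ
        (∑ i ∈ ξ.support, ∑ j ∈ η.support, starRingEnd ℂ (ξ i) * η j * β i j) := by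
      simp only [f, γ, Finsupp.linearCombination_apply, Finsupp.sum, smul_eq_mul, map_sum, map_mul,
        Complex.conj_conj, Finset.mul_sum, mul_assoc]
    rw [e, RCLike.norm_conj]
    exact (h ξ η).trans_eq (by ring)
  let r : (κ →₀ ℂ) → E := fun η =>
    (InnerProductSpace.toDual ℂ E).symm ((f η).extendOfNorm (Finsupp.linearCombination ℂ x))
  have hr : ∀ η i, inner ℂ (x i) (r η) = γ η i := by
    intro η i
    rw [← inner_conj_symm, InnerProductSpace.toDual_symm_apply]
    have := LinearMap.extendOfNorm_eq (f := f η) hx ⟨_, hf η⟩ (Finsupp.single i 1)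
    rw [Finsupp.linearCombination_single, one_smul] at this
    rw [this]
    simp [f]
  have hnr : ∀ η, ‖r η‖ ≤ C * ‖Finsupp.linearCombination ℂ y η‖ := by
    intro η
    rw [LinearIsometryEquiv.norm_map]
    exact ContinuousLinearMap.opNorm_le_bound _ (by positivity) fun e =>
      LinearMap.norm_extendOfNorm_apply_le hx _ (hf η) e
  let R₀ : (κ →₀ ℂ) →ₗ[ℂ] E :=
    { toFun := r
      map_add' := fun η η' => by
        rw [← sub_eq_zero]
        refine hx.eq_zero fun i => ?_
        rw [inner_sub_right, inner_add_right, hr, hr, hr, γ_eq, γ_eq, γ_eq, map_add, sub_self]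
      map_smul' := fun c η => by
        rw [← sub_eq_zero]
        refine hx.eq_zero fun i => ?_
        rw [inner_sub_right, RingHom.id_apply, inner_smul_right, hr, hr, γ_eq, γ_eq, map_smul,
          smul_eq_mul, sub_self] }
  refine ⟨R₀.extendOfNorm (Finsupp.linearCombination ℂ y), fun i j => ?_⟩
  have := LinearMap.extendOfNorm_eq (f := R₀) hy ⟨C, hnr⟩ (Finsupp.single j 1)
  rw [Finsupp.linearCombination_single, one_smul] at this
  rw [this]
  change inner ℂ (x i) (r _) = _
  rw [hr, γ_eq]
  simp

/-- The isometry `(f i)_i ↦ ∑ i, f i ⊗ c i` given by an orthonormal system `c`. -/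
theorem norm_sum_htmul {n : ℕ} {c : Fin n → K} (hc : Orthonormal ℂ c)
    (f : PiLp 2 (fun _ : Fin n => H)) : ‖∑ i, htmul (f i) (c i)‖ = ‖f‖ := by
  have h : inner ℂ (∑ i, htmul (f i) (c i)) (∑ i, htmul (f i) (c i)) = inner ℂ f f := by
    simp only [sum_inner, inner_sum, inner_htmul, orthonormal_iff_ite.1 hc, PiLp.inner_apply]
    simp
  rw [inner_self_eq_norm_sq_to_K, inner_self_eq_norm_sq_to_K] at h
  have h' : ‖∑ i, htmul (f i) (c i)‖ ^ 2 = ‖f‖ ^ 2 := by exact_mod_cast h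
  exact (sq_eq_sq₀ (norm_nonneg _) (norm_nonneg _)).1 h'

theorem norm_matOp_slice_le {n : ℕ} {c : Fin n → K} (hc : Orthonormal ℂ c)
    (T : HTensor H K →L[ℂ] HTensor H K) :
    ‖matOp (fun i j => slice (c i) (c j) T)‖ ≤ ‖T‖ := by
  refine norm_le_of_inner _ (norm_nonneg _) fun f g => ?_
  have : inner ℂ f (matOp (fun i j => slice (c i) (c j) T) g) =
      inner ℂ (∑ i, htmul (f i) (c i)) (T (∑ j, htmul (g j) (c j))) := by
    rw [inner_matOp]
    simp only [inner_slice, map_sum, sum_inner, inner_sum]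
    exact Finset.sum_comm
  rw [this]
  refine (norm_inner_le_norm _ _).trans ?_
  rw [norm_sum_htmul hc, mul_comm ‖T‖, mul_assoc]
  gcongr
  exact (T.le_opNorm _).trans_eq (by rw [norm_sum_htmul hc])

section Ampliation

variable {L : Type w} [NormedAddCommGroup L] [InnerProductSpace ℂ L] [CompleteSpace L]

theorem slice_add_left (x x' y : K) (T : HTensor H K →L[ℂ] HTensor H K) :
    slice (x + x') y T = slice x y T + slice x' y T := by
  simp [slice, ket_add]

theorem slice_smul_left (c : ℂ) (x y : K) (T : HTensor H K →L[ℂ] HTensor H K) :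
    slice (c • x) y T = starRingEnd ℂ c • slice x y T := by
  simp [slice, ket_smul, map_smulₛₗ]

theorem slice_add_right (x y y' : K) (T : HTensor H K →L[ℂ] HTensor H K) :
    slice x (y + y') T = slice x y T + slice x y' T := by
  simp [slice, ket_add]

theorem slice_smul_right (c : ℂ) (x y : K) (T : HTensor H K →L[ℂ] HTensor H K) :
    slice x (c • y) T = c • slice x y T := by
  simp [slice, ket_smul]

theorem norm_slice_le (x y : K) (T : HTensor H K →L[ℂ] HTensor H K) :
    ‖slice x y T‖ ≤ ‖T‖ * ‖x‖ * ‖y‖ := by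
  refine norm_le_of_inner _ (by positivity) fun u v => ?_
  rw [inner_slice]
  refine (norm_inner_le_norm _ _).trans ?_
  calc _ ≤ ‖htmul u x‖ * (‖T‖ * ‖htmul v y‖) := by gcongr; exact T.le_opNorm _
    _ = _ := by rw [norm_htmul, norm_htmul]; ring

theorem CBNormLE.norm_le {A : VonNeumannAlgebra H} {φ : A →ₗ[ℂ] (K →L[ℂ] K)} {C : ℝ}
    (hC : CBNormLE φ C) (hC0 : 0 ≤ C) (a : A) : ‖φ a‖ ≤ C * ‖(a : H →L[ℂ] H)‖ := by
  have h1 := hC 1 (fun _ _ => a)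
  have h2 : ‖matOp (fun _ _ : Fin 1 => (a : H →L[ℂ] H))‖ ≤ ‖(a : H →L[ℂ] H)‖ := by
    refine norm_le_of_inner _ (norm_nonneg _) fun f g => ?_
    rw [inner_matOp]
    simp only [Fin.sum_univ_one, Fin.isValue]
    refine (norm_inner_le_norm _ _).trans ?_
    rw [mul_comm ‖(a : H →L[ℂ] H)‖, mul_assoc]
    gcongr
    · exact PiLp.norm_apply_le f 0
    · refine (ContinuousLinearMap.le_opNorm _ _).trans ?_
      gcongr
      exact PiLp.norm_apply_le g 0
  have h3 : ‖φ a‖ ≤ ‖matOp (fun _ _ : Fin 1 => φ a)‖ := by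
    refine ContinuousLinearMap.opNorm_le_bound _ (norm_nonneg _) fun v => ?_
    have e1 : ‖(WithLp.toLp 2 fun _ => v : PiLp 2 (fun _ : Fin 1 => K))‖ = ‖v‖ := by
      simp [PiLp.norm_eq_of_L2]
    have e2 : ‖φ a v‖ = ‖matOp (fun _ _ : Fin 1 => φ a) (WithLp.toLp 2 fun _ => v)‖ := by
      rw [PiLp.norm_eq_of_L2]
      simp [matOp_apply]
    rw [e2, ← e1]
    exact ContinuousLinearMap.le_opNorm _ _
  exact h3.trans (h1.trans (by gcongr))

theorem sum_comm_four {α β γ δ : Type*} (a : Finset α) (b : Finset β) (c : Finset γ)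
    (d : Finset δ) (f : α → β → γ → δ → ℂ) :
    ∑ i ∈ a, ∑ j ∈ b, ∑ p ∈ c, ∑ q ∈ d, f i j p q =
      ∑ p ∈ c, ∑ q ∈ d, ∑ i ∈ a, ∑ j ∈ b, f i j p q := by
  calc _ = ∑ i ∈ a, ∑ p ∈ c, ∑ j ∈ b, ∑ q ∈ d, f i j p q :=
        Finset.sum_congr rfl fun i _ => Finset.sum_comm
    _ = ∑ p ∈ c, ∑ i ∈ a, ∑ j ∈ b, ∑ q ∈ d, f i j p q := Finset.sum_comm
    _ = ∑ p ∈ c, ∑ i ∈ a, ∑ q ∈ d, ∑ j ∈ b, f i j p q :=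
        Finset.sum_congr rfl fun p _ => Finset.sum_congr rfl fun i _ => Finset.sum_comm
    _ = _ := Finset.sum_congr rfl fun p _ => Finset.sum_comm

/-- The form bound behind the existence of ampliations. -/
theorem ampliation_form_bound {A : VonNeumannAlgebra H} {φ : A →ₗ[ℂ] (K →L[ℂ] K)} {C : ℝ}
    (hC : CBNormLE φ C) (hC0 : 0 ≤ C) {κ : Type*} {e : κ → L} (he : Orthonormal ℂ e)
    (T : vnTensor A (boundedOps L)) (ξ η : (K × κ) →₀ ℂ) :
    ‖∑ p ∈ ξ.support, ∑ q ∈ η.support, starRingEnd ℂ (ξ p) * η q *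
        inner ℂ p.1 (φ (sliceMap A (boundedOps L) (e p.2) (e q.2) T) q.1)‖ ≤
      (C * ‖(T : HTensor H L →L[ℂ] HTensor H L)‖) *
        ‖Finsupp.linearCombination ℂ (fun p : K × κ => htmul p.1 (e p.2)) ξ‖ *
        ‖Finsupp.linearCombination ℂ (fun p : K × κ => htmul p.1 (e p.2)) η‖ := by
  classical
  let s : Finset κ := (ξ.support ∪ η.support).image Prod.snd
  let c : Fin s.card → κ := fun i => (s.equivFin.symm i : κ)
  have hc_inj : Function.Injective c := Subtype.val_injective.comp s.equivFin.symm.injective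
  have hc_mem : ∀ k ∈ s, ∃ i, c i = k := fun k hk =>
    ⟨s.equivFin ⟨k, hk⟩, by simp [c]⟩
  have hon : Orthonormal ℂ (fun i => e (c i)) := he.comp c hc_inj
  let F : ((K × κ) →₀ ℂ) → PiLp 2 (fun _ : Fin s.card => K) := fun ζ =>
    WithLp.toLp 2 fun i => ∑ p ∈ ζ.support, if p.2 = c i then ζ p • p.1 else 0
  have hF : ∀ ζ : (K × κ) →₀ ℂ, (∀ p ∈ ζ.support, p.2 ∈ s) →
      Finsupp.linearCombination ℂ (fun p : K × κ => htmul p.1 (e p.2)) ζ =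
        ∑ i, htmul (F ζ i) (e (c i)) := by
    intro ζ hζ
    have h1 : ∀ i, htmul (F ζ i) (e (c i)) =
        ∑ p ∈ ζ.support, if p.2 = c i then ζ p • htmul p.1 (e p.2) else 0 := by
      intro i
      rw [← ket_apply, map_sum]
      refine Finset.sum_congr rfl fun p _ => ?_
      split_ifs with h
      · rw [map_smul, ket_apply, h]
      · exact map_zero (ket K _)
    simp only [h1]
    rw [Finset.sum_comm, Finsupp.linearCombination_apply, Finsupp.sum]
    refine Finset.sum_congr rfl fun p hp => ?_
    obtain ⟨i, hi⟩ := hc_mem _ (hζ p hp)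
    rw [Finset.sum_eq_single i]
    · rw [if_pos hi.symm]
    · intro j _ hj
      rw [if_neg]
      intro h
      exact hj (hc_inj (h.symm.trans hi.symm))
    · simp
  have hsξ : ∀ p ∈ ξ.support, p.2 ∈ s := fun p hp =>
    Finset.mem_image_of_mem _ (Finset.mem_union_left _ hp)
  have hsη : ∀ p ∈ η.support, p.2 ∈ s := fun p hp =>
    Finset.mem_image_of_mem _ (Finset.mem_union_right _ hp)
  let a : Fin s.card → Fin s.card → A := fun i j =>
    sliceMap A (boundedOps L) (e (c i)) (e (c j)) T
  have hsum : (∑ p ∈ ξ.support, ∑ q ∈ η.support, starRingEnd ℂ (ξ p) * η q *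
      inner ℂ p.1 (φ (sliceMap A (boundedOps L) (e p.2) (e q.2) T) q.1)) =
      inner ℂ (F ξ) (matOp (fun i j => φ (a i j)) (F η)) := by
    rw [inner_matOp]
    have h2 : ∀ i j, inner ℂ (F ξ i) (φ (a i j) (F η j)) =
        ∑ p ∈ ξ.support, ∑ q ∈ η.support, if p.2 = c i ∧ q.2 = c j then
          starRingEnd ℂ (ξ p) * η q *
            inner ℂ p.1 (φ (sliceMap A (boundedOps L) (e p.2) (e q.2) T) q.1) else 0 := by
      intro i j
      simp only [F, sum_inner, map_sum, inner_sum]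
      rw [Finset.sum_comm]
      refine Finset.sum_congr rfl fun p _ => Finset.sum_congr rfl fun q _ => ?_
      by_cases hp : p.2 = c i
      · by_cases hq : q.2 = c j
        · simp only [hp, hq, and_self, if_true, map_smul, inner_smul_left, inner_smul_right, a]
          ring
        · simp [hq]
      · simp [hp]
    simp only [h2]
    symm
    calc (∑ i, ∑ j, ∑ p ∈ ξ.support, ∑ q ∈ η.support, if p.2 = c i ∧ q.2 = c j then
          starRingEnd ℂ (ξ p) * η q *
            inner ℂ p.1 (φ (sliceMap A (boundedOps L) (e p.2) (e q.2) T) q.1) else 0)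
        = ∑ p ∈ ξ.support, ∑ q ∈ η.support, ∑ i, ∑ j, if p.2 = c i ∧ q.2 = c j then
          starRingEnd ℂ (ξ p) * η q *
            inner ℂ p.1 (φ (sliceMap A (boundedOps L) (e p.2) (e q.2) T) q.1) else 0 := by
          exact sum_comm_four _ _ _ _ _
      _ = _ := by
          refine Finset.sum_congr rfl fun p hp => Finset.sum_congr rfl fun q hq => ?_
          obtain ⟨i, hi⟩ := hc_mem _ (hsξ p hp)
          obtain ⟨j, hj⟩ := hc_mem _ (hsη q hq)
          rw [Finset.sum_eq_single i, Finset.sum_eq_single j, if_pos ⟨hi.symm, hj.symm⟩]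
          · intro j' _ hj'
            rw [if_neg]
            rintro ⟨-, h⟩
            exact hj' (hc_inj (h.symm.trans hj.symm))
          · simp
          · intro i' _ hi'
            refine Finset.sum_eq_zero fun j' _ => ?_
            rw [if_neg]
            rintro ⟨h, -⟩
            exact hi' (hc_inj (h.symm.trans hi.symm))
          · simp
  rw [hsum, hF ξ hsξ, hF η hsη, norm_sum_htmul hon, norm_sum_htmul hon]
  refine (norm_inner_le_norm _ _).trans ?_
  have h3 : ‖matOp (fun i j => φ (a i j))‖ ≤ C * ‖(T : HTensor H L →L[ℂ] HTensor H L)‖ :=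
    (hC _ a).trans (by gcongr; exact norm_matOp_slice_le hon _)
  calc _ ≤ ‖F ξ‖ * (‖matOp (fun i j => φ (a i j))‖ * ‖F η‖) := by
        gcongr; exact ContinuousLinearMap.le_opNorm _ _
    _ ≤ ‖F ξ‖ * ((C * ‖(T : HTensor H L →L[ℂ] HTensor H L)‖) * ‖F η‖) := by gcongr
    _ = _ := by ring

theorem IsCompletelyBounded.exists_nonneg {A : VonNeumannAlgebra H} {φ : A →ₗ[ℂ] (K →L[ℂ] K)}
    (hφ : IsCompletelyBounded φ) : ∃ C, 0 ≤ C ∧ CBNormLE φ C := by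
  obtain ⟨C, hC⟩ := hφ
  exact ⟨max C 0, le_max_right _ _, fun n a => (hC n a).trans (by gcongr; exact le_max_left _ _)⟩

theorem exists_ampliation {A : VonNeumannAlgebra H} {φ : A →ₗ[ℂ] (K →L[ℂ] K)}
    (hφ : IsCompletelyBounded φ) (T : vnTensor A (boundedOps L)) :
    ∃ R : HTensor K L →L[ℂ] HTensor K L,
      ∀ x y : L, slice x y R = φ (sliceMap A (boundedOps L) x y T) := by
  obtain ⟨C, hC0, hC⟩ := hφ.exists_nonneg
  obtain ⟨w, e, -⟩ := exists_hilbertBasis ℂ L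
  have he : IsTotal (e : w → L) := isTotal_iff.2 e.dense_span
  have htot : IsTotal (fun p : K × w => htmul p.1 (e p.2)) :=
    htmul_total (x := (id : K → K)) isTotal_id he
  obtain ⟨R, hR⟩ := exists_op_of_form htot htot
    (fun p q => inner ℂ p.1 (φ (sliceMap A (boundedOps L) (e p.2) (e q.2) T) q.1))
    (C := C * ‖(T : HTensor H L →L[ℂ] HTensor H L)‖) (by positivity)
    (ampliation_form_bound hC hC0 e.orthonormal T)
  refine ⟨R, fun x y => ?_⟩
  refine ContinuousLinearMap.ext fun v => ext_inner_left ℂ fun u => ?_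
  -- linear dependence on `y`
  have hbd : ∀ x y : L, ‖inner ℂ u (φ (sliceMap A (boundedOps L) x y T) v)‖ ≤
      (C * ‖(T : HTensor H L →L[ℂ] HTensor H L)‖ * ‖u‖ * ‖v‖) * ‖x‖ * ‖y‖ := by
    intro x y
    refine (norm_inner_le_norm _ _).trans ?_
    calc _ ≤ ‖u‖ * ((C * (‖(T : HTensor H L →L[ℂ] HTensor H L)‖ * ‖x‖ * ‖y‖)) * ‖v‖) := by
          gcongr
          refine (ContinuousLinearMap.le_opNorm _ _).trans ?_
          gcongr
          refine (hC.norm_le hC0 _).trans ?_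
          gcongr
          exact norm_slice_le _ _ _
      _ = _ := by ring
  have hsr : ∀ (x y y' : L), sliceMap A (boundedOps L) x (y + y') T =
      sliceMap A (boundedOps L) x y T + sliceMap A (boundedOps L) x y' T :=
    fun x y y' => Subtype.ext (slice_add_right x y y' _)
  have hsr' : ∀ (c : ℂ) (x y : L), sliceMap A (boundedOps L) x (c • y) T =
      c • sliceMap A (boundedOps L) x y T :=
    fun c x y => Subtype.ext (slice_smul_right c x y _)
  have hsl : ∀ (x x' y : L), sliceMap A (boundedOps L) (x + x') y T =
      sliceMap A (boundedOps L) x y T + sliceMap A (boundedOps L) x' y T :=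
    fun x x' y => Subtype.ext (slice_add_left x x' y _)
  have hsl' : ∀ (c : ℂ) (x y : L), sliceMap A (boundedOps L) (c • x) y T =
      starRingEnd ℂ c • sliceMap A (boundedOps L) x y T :=
    fun c x y => Subtype.ext (slice_smul_left c x y _)
  let P : L → L →L[ℂ] ℂ := fun x => LinearMap.mkContinuous
    { toFun := fun y => inner ℂ u (φ (sliceMap A (boundedOps L) x y T) v)
      map_add' := fun y y' => by simp [hsr]
      map_smul' := fun c y => by simp [hsr'] }
    _ (hbd x)
  let Q : L → L →L[ℂ] ℂ := fun y => LinearMap.mkContinuous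
    { toFun := fun x => inner ℂ (φ (sliceMap A (boundedOps L) x y T) v) u
      map_add' := fun x x' => by simp [hsl]
      map_smul' := fun c x => by simp [hsl', mul_comm] }
    (C * ‖(T : HTensor H L →L[ℂ] HTensor H L)‖ * ‖u‖ * ‖v‖ * ‖y‖)
    (fun x => by
      change ‖inner ℂ (φ (sliceMap A (boundedOps L) x y T) v) u‖ ≤ _
      rw [norm_inner_symm]
      exact (hbd x y).trans_eq (by ring))
  have step1 : ∀ (i : w), P (e i) = (innerSL ℂ (htmul u (e i))).comp (R.comp (leftKet L v)) := by
    intro i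
    refine he.clm_ext fun j => ?_
    have := hR (u, i) (v, j)
    simpa [P] using this.symm
  have step2 : Q y = (innerSL ℂ (R (htmul v y))).comp (leftKet L u) := by
    refine he.clm_ext fun i => ?_
    have := congrArg (starRingEnd ℂ) (congrArg (fun f => f y) (step1 i))
    simpa [P, Q] using this
  have := congrArg (starRingEnd ℂ) (congrArg (fun f => f x) step2)
  rw [inner_slice]
  simpa [Q] using this.symm

/-- The ampliation `φ ⊗ id : A ⊗ B(L) → B(K ⊗ L)` of a completely bounded map `φ : A → B(K)`,
determined by its slices: `E^x (φ ⊗ id)(T) E_y = φ (E^x T E_y)` for all `x` and `y` in `L`.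
For normal `φ` it is the normal extension of `a ⊗ b ↦ φ a ⊗ b`. -/
def ampliation {A : VonNeumannAlgebra H} (φ : A →ₗ[ℂ] (K →L[ℂ] K)) (hφ : IsCompletelyBounded φ)
    (T : vnTensor A (boundedOps L)) : HTensor K L →L[ℂ] HTensor K L :=
  (exists_ampliation hφ T).choose

theorem slice_ampliation {A : VonNeumannAlgebra H} {φ : A →ₗ[ℂ] (K →L[ℂ] K)}
    (hφ : IsCompletelyBounded φ) (T : vnTensor A (boundedOps L)) (x y : L) :
    slice x y (ampliation φ hφ T) = φ (sliceMap A (boundedOps L) x y T) :=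
  (exists_ampliation hφ T).choose_spec x y

theorem slice_ext {S T : HTensor K L →L[ℂ] HTensor K L}
    (h : ∀ x y : L, slice x y S = slice x y T) : S = T := by
  refine htensor_ext fun v y => ?_
  rw [← sub_eq_zero]
  refine htmul_total'.eq_zero fun p => ?_
  rw [inner_sub_right, ← inner_slice, ← inner_slice, h, sub_self]

theorem slice_opTensor (a : H →L[ℂ] H) (b : K →L[ℂ] K) (x y : K) :
    slice x y (opTensor a b) = inner ℂ x (b y) • a := by
  refine ContinuousLinearMap.ext fun v => ext_inner_left ℂ fun u => ?_
  rw [inner_slice, opTensor_htmul, inner_htmul, smul_apply,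
    inner_smul_right, mul_comm]

theorem ampliation_opTensor {A : VonNeumannAlgebra H} {φ : A →ₗ[ℂ] (K →L[ℂ] K)}
    (hφ : IsCompletelyBounded φ) (a : A) (b : L →L[ℂ] L) :
    ampliation φ hφ ⟨opTensor a b, opTensor_mem A (boundedOps L) a.2 (mem_boundedOps b)⟩ =
      opTensor (φ a) b := by
  refine slice_ext fun x y => ?_
  rw [slice_ampliation, slice_opTensor, ← map_smul]
  exact congrArg φ (Subtype.ext (slice_opTensor _ _ _ _))

end Ampliation

end VN

/-! ### Boson Fock space -/

section Fock

/-- A bundled Hilbert space, used to define tensor powers by recursion. -/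
structure HilbertBundle : Type (u + 1) where
  carrier : Type u
  [group : NormedAddCommGroup carrier]
  [inner : InnerProductSpace ℂ carrier]
  [complete : CompleteSpace carrier]

variable (K : Type v) [NormedAddCommGroup K] [InnerProductSpace ℂ K]

/-- The tensor powers of `K`: the zeroth one is one-dimensional, and the next ones are given by
`K^{⊗ (n + 1)} = K ⊗ K^{⊗ n}`. -/
def tensorPowBundle : ℕ → HilbertBundle.{v}
  | 0 => ⟨EuclideanSpace ℂ PUnit.{v + 1}⟩
  | n + 1 =>
    letI := (tensorPowBundle n).group
    letI := (tensorPowBundle n).inner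
    ⟨HTensor K (tensorPowBundle n).carrier⟩

/-- The `n`-th Hilbert-space tensor power of `K`. -/
def TensorPow (n : ℕ) : Type v := (tensorPowBundle K n).carrier

instance (n : ℕ) : NormedAddCommGroup (TensorPow K n) := (tensorPowBundle K n).group

instance (n : ℕ) : InnerProductSpace ℂ (TensorPow K n) := (tensorPowBundle K n).inner

instance (n : ℕ) : CompleteSpace (TensorPow K n) := (tensorPowBundle K n).complete

variable {K}

/-- The vector `f ⊗ ⋯ ⊗ f` (`n` factors). -/
def powVec (f : K) : (n : ℕ) → TensorPow K n
  | 0 => (EuclideanSpace.single PUnit.unit 1 : EuclideanSpace ℂ PUnit.{v + 1})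
  | n + 1 => (htmul f (powVec f n) : HTensor K (TensorPow K n))

theorem inner_powVec (f g : K) (n : ℕ) :
    inner ℂ (powVec f n) (powVec g n) = inner ℂ f g ^ n := by
  induction n with
  | zero =>
    change inner ℂ (EuclideanSpace.single PUnit.unit 1 : EuclideanSpace ℂ PUnit.{v + 1})
      (EuclideanSpace.single PUnit.unit 1) = _
    simp
  | succ n ih =>
    change inner ℂ (htmul f (powVec f n)) (htmul g (powVec g n)) = _
    rw [inner_htmul, ih, pow_succ']

theorem norm_powVec (f : K) (n : ℕ) : ‖powVec f n‖ = ‖f‖ ^ n := by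
  have h := inner_powVec f f n
  rw [inner_self_eq_norm_sq_to_K, inner_self_eq_norm_sq_to_K] at h
  have h' : ‖powVec f n‖ ^ 2 = (‖f‖ ^ 2) ^ n := by exact_mod_cast h
  rw [← pow_mul, mul_comm, pow_mul] at h'
  exact (sq_eq_sq₀ (norm_nonneg _) (by positivity)).1 h'

theorem powVec_smul (c : ℂ) (f : K) (n : ℕ) : powVec (c • f) n = c ^ n • powVec f n := by
  induction n with
  | zero => rw [pow_zero, one_smul]; rfl
  | succ n ih =>
    change htmul (c • f) (powVec (c • f) n) = c ^ (n + 1) • htmul f (powVec f n)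
    rw [ih, pow_succ, mul_smul, ← ket_apply, map_smul, ket_apply, ← leftKet_apply, map_smul,
      smul_comm, leftKet_apply]

variable (K)

/-- The full Fock space `⨁ n, K^{⊗ n}`. -/
abbrev FullFock : Type v := lp (fun n => TensorPow K n) 2

/-- The symmetric (Boson) Fock space as a closed subspace of the full one: the Hilbert-space
direct sum of the symmetric tensor powers, the `n`-th one being the closed linear span of the
vectors `f ⊗ ⋯ ⊗ f`. -/
def fockSubspace : Submodule ℂ (FullFock K) :=
  (Submodule.span ℂ
    {ξ | ∃ (n : ℕ) (f : K), ξ = lp.single 2 n (powVec f n)}).topologicalClosure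

/-- Boson Fock space over `K`. -/
def Fock : Type v := fockSubspace K

instance : NormedAddCommGroup (Fock K) := inferInstanceAs (NormedAddCommGroup (fockSubspace K))

instance : InnerProductSpace ℂ (Fock K) := inferInstanceAs (InnerProductSpace ℂ (fockSubspace K))

instance : CompleteSpace (Fock K) :=
  (Submodule.isClosed_topologicalClosure _).completeSpace_coe

variable {K}

theorem hasSum_norm_exp (f : K) :
    Summable fun n : ℕ => ‖((√(n.factorial : ℝ))⁻¹ : ℂ) • powVec f n‖ ^ 2 := by
  have h := Real.summable_pow_div_factorial (‖f‖ ^ 2)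
  refine h.congr fun n => ?_
  rw [norm_smul, norm_inv, Complex.norm_real, mul_pow, norm_powVec, Real.norm_eq_abs, inv_pow, sq_abs,
    Real.sq_sqrt (by positivity), ← pow_mul, ← pow_mul, mul_comm 2 n]
  ring

/-- The exponential vector `e(f) = ⨁ n, (n!)^{-1/2} f ⊗ ⋯ ⊗ f`, in the full Fock space. -/
def fullExpVec (f : K) : FullFock K :=
  ⟨fun n => ((√(n.factorial : ℝ))⁻¹ : ℂ) • powVec f n, by
    refine memℓp_gen ?_
    simpa using hasSum_norm_exp f⟩

theorem fullExpVec_mem (f : K) : fullExpVec f ∈ fockSubspace K := by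
  refine Submodule.isClosed_topologicalClosure _ |>.mem_of_tendsto
    (lp.hasSum_single (by simp) (fullExpVec f)) (Filter.Eventually.of_forall fun s => ?_)
  refine Submodule.sum_mem _ fun n _ => ?_
  change lp.single 2 n (((√(n.factorial : ℝ))⁻¹ : ℂ) • powVec f n) ∈ fockSubspace K
  rw [lp.single_smul]
  exact Submodule.smul_mem _ _ (Submodule.le_topologicalClosure _ (Submodule.subset_span ⟨n, f, rfl⟩))

/-- The exponential vector `e(f)` in Boson Fock space. -/
def expVec (f : K) : Fock K := (⟨fullExpVec f, fullExpVec_mem f⟩ : fockSubspace K)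

theorem inner_expVec (f g : K) : inner ℂ (expVec f) (expVec g) = Complex.exp (inner ℂ f g) := by
  change inner ℂ (fullExpVec f) (fullExpVec g) = _
  have h1 := lp.hasSum_inner (𝕜 := ℂ) (fullExpVec f) (fullExpVec g)
  have h2 : HasSum (fun n : ℕ => ((n.factorial : ℂ))⁻¹ • (inner ℂ f g : ℂ) ^ n)
      (Complex.exp (inner ℂ f g)) := by
    rw [Complex.exp_eq_exp_ℂ]
    exact NormedSpace.exp_series_hasSum_exp' (𝕂 := ℂ) _
  refine h1.unique (h2.congr_fun fun n => ?_)
  change inner ℂ (((√(n.factorial : ℝ))⁻¹ : ℂ) • powVec f n)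
    (((√(n.factorial : ℝ))⁻¹ : ℂ) • powVec g n) = _
  rw [inner_smul_left, inner_smul_right, inner_powVec, ← mul_assoc, smul_eq_mul, map_inv₀,
    Complex.conj_ofReal, ← mul_inv, ← Complex.ofReal_mul, Real.mul_self_sqrt (by positivity),
    Complex.ofReal_natCast]

theorem inner_single_powVec_eq_zero {ξ : FullFock K}
    (h : ∀ f : K, inner ℂ (fullExpVec f) ξ = 0) (n : ℕ) (f : K) :
    inner ℂ (powVec f n) (ξ n) = 0 := by
  let c : ℕ → ℂ := fun n => ((√(n.factorial : ℝ))⁻¹ : ℂ) * inner ℂ (powVec f n) (ξ n)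
  have hs : ∀ z : ℂ, HasSum (fun n => z ^ n • c n) 0 := by
    intro z
    have h1 := lp.hasSum_inner (𝕜 := ℂ) (fullExpVec (starRingEnd ℂ z • f)) ξ
    rw [h] at h1
    refine h1.congr_fun fun n => ?_
    change _ = inner ℂ (((√(n.factorial : ℝ))⁻¹ : ℂ) • powVec (starRingEnd ℂ z • f) n) (ξ n)
    rw [powVec_smul, inner_smul_left, inner_smul_left, map_inv₀, Complex.conj_ofReal, map_pow,
      Complex.conj_conj, smul_eq_mul]
    ring
  have hp : HasFPowerSeriesAt (fun _ : ℂ => (0 : ℂ)) (FormalMultilinearSeries.ofScalars ℂ c) 0 := by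
    rw [hasFPowerSeriesAt_iff]
    refine Filter.Eventually.of_forall fun z => ?_
    simpa only [FormalMultilinearSeries.coeff_ofScalars] using hs z
  have h0 : c n = 0 := by
    have := hp.eq_zero
    rw [← FormalMultilinearSeries.coeff_ofScalars (𝕜 := ℂ) (p := c) (n := n), this]
    rfl
  refine (mul_eq_zero.1 h0).resolve_left (inv_ne_zero ?_)
  exact_mod_cast (Real.sqrt_pos.2 (by positivity)).ne'

theorem expVec_total : IsTotal (expVec : K → Fock K) := by
  refine isTotal_of_forall fun ξ hξ => ?_
  have key := inner_single_powVec_eq_zero (ξ := (show fockSubspace K from ξ).1) hξ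
  have h1 : (show fockSubspace K from ξ).1 ∈ (Submodule.span ℂ
      {ξ | ∃ (n : ℕ) (f : K), ξ = lp.single 2 n (powVec f n)})ᗮ := by
    rw [Submodule.mem_orthogonal]
    intro v hv
    induction hv using Submodule.span_induction with
    | mem w hw =>
      obtain ⟨n, f, rfl⟩ := hw
      rw [lp.inner_single_left]
      exact key n f
    | zero => simp
    | add a b _ _ ha hb => rw [inner_add_left, ha, hb, add_zero]
    | smul c a _ ha => rw [inner_smul_left, ha, mul_zero]
  rw [← Submodule.orthogonal_closure] at h1
  have h2 := (Submodule.inner_right_of_mem_orthogonal (show fockSubspace K from ξ).2 h1)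
  exact Subtype.ext (inner_self_eq_zero.1 h2)

/-- The vacuum vector. -/
def vacuum (K : Type v) [NormedAddCommGroup K] [InnerProductSpace ℂ K] : Fock K := expVec 0

/-- The orthogonal projection `|Ω⟩⟨Ω|` onto the vacuum vector. -/
def vacuumProj (K : Type v) [NormedAddCommGroup K] [InnerProductSpace ℂ K] : Fock K →L[ℂ] Fock K :=
  InnerProductSpace.rankOne ℂ (vacuum K) (vacuum K)

end Fock

/-! ### Noise spaces, shifts and adapted factorisations -/

section Noise

variable {K : Type v} [NormedAddCommGroup K] [InnerProductSpace ℂ K]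

/-- Second quantisation of a unitary operator: `e(f) ↦ e(U f)`. -/
def secondQuantisation {K' : Type w} [NormedAddCommGroup K'] [InnerProductSpace ℂ K']
    (U : K ≃ₗᵢ[ℂ] K') : Fock K ≃ₗᵢ[ℂ] Fock K' :=
  gramUnitary expVec (fun f => expVec (U f))
    (fun f g => by rw [inner_expVec, inner_expVec, LinearIsometryEquiv.inner_map_map])
    expVec_total
    (isTotal_iff.2 <| by
      have : Set.range (fun f => expVec (U f)) = Set.range (expVec : K' → Fock K') :=
        U.surjective.range_comp expVec
      rw [this]
      exact isTotal_iff.1 expVec_total)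

theorem htmul_expVec_total {H : Type u} {K : Type v} {L : Type w} [NormedAddCommGroup H]
    [InnerProductSpace ℂ H] [NormedAddCommGroup K] [InnerProductSpace ℂ K]
    [NormedAddCommGroup L] [InnerProductSpace ℂ L] :
    IsTotal fun p : (H × K) × L => htmul (htmul p.1.1 (expVec p.1.2)) (expVec p.2) :=
  htmul_total (x := fun q : H × K => htmul q.1 (expVec q.2)) (y := (expVec : L → Fock L))
    (htmul_total (x := (id : H → H)) isTotal_id expVec_total) expVec_total

variable (𝔨 : Type v) [NormedAddCommGroup 𝔨] [InnerProductSpace ℂ 𝔨] [CompleteSpace 𝔨]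

/-- The space `L²(J; 𝔨)`, for Lebesgue measure on `J ⊆ ℝ`. -/
abbrev L2 (J : Set ℝ) : Type v := Lp 𝔨 2 (volume.restrict J)

/-- Fock space over `L²(ℝ₊; 𝔨)`. -/
abbrev Noise : Type v := Fock (L2 𝔨 (Set.Ici 0))

/-- Fock space over `L²([0, t); 𝔨)`. -/
abbrev NoisePast (t : ℝ≥0) : Type v := Fock (L2 𝔨 (Set.Ico 0 (t : ℝ)))

/-- Fock space over `L²([t, ∞); 𝔨)`. -/
abbrev NoiseFuture (t : ℝ≥0) : Type v := Fock (L2 𝔨 (Set.Ici (t : ℝ)))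

variable {𝔨}

/-- Restriction of functions, `L²(J'; 𝔨) → L²(J; 𝔨)` for `J ⊆ J'`. -/
def restrictL2 {J J' : Set ℝ} (h : J ⊆ J') (f : L2 𝔨 J') : L2 𝔨 J :=
  MemLp.toLp f ((Lp.memLp f).mono_measure (Measure.restrict_mono h le_rfl))

theorem restrictL2_ae {J J' : Set ℝ} (h : J ⊆ J') (f : L2 𝔨 J') :
    restrictL2 h f =ᵐ[volume.restrict J] f := MemLp.coeFn_toLp _

theorem pastSet_subset (t : ℝ≥0) : Set.Ico 0 (t : ℝ) ⊆ Set.Ici 0 := Set.Ico_subset_Ici_self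

theorem futureSet_subset (t : ℝ≥0) : Set.Ici (t : ℝ) ⊆ Set.Ici 0 := Set.Ici_subset_Ici.2 t.2

theorem inner_restrictL2 {J J' : Set ℝ} (h : J ⊆ J') (f g : L2 𝔨 J') :
    inner ℂ (restrictL2 h f) (restrictL2 h g) = ∫ x in J, inner ℂ (f x) (g x) := by
  rw [L2.inner_def]
  refine integral_congr_ae ?_
  filter_upwards [restrictL2_ae h f, restrictL2_ae h g] with x hf hg
  rw [hf, hg]

theorem inner_eq_restrict_add (t : ℝ≥0) (f g : L2 𝔨 (Set.Ici 0)) :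
    inner ℂ f g = inner ℂ (restrictL2 (pastSet_subset t) f) (restrictL2 (pastSet_subset t) g) +
      inner ℂ (restrictL2 (futureSet_subset t) f) (restrictL2 (futureSet_subset t) g) := by
  have hi : IntegrableOn (fun x => inner ℂ (f x) (g x)) (Set.Ici 0) volume :=
    L2.integrable_inner f g
  rw [inner_restrictL2, inner_restrictL2, L2.inner_def,
    ← setIntegral_union _ measurableSet_Ici (hi.mono_set (pastSet_subset t))
      (hi.mono_set (futureSet_subset t)), Set.Ico_union_Ici_eq_Ici (NNReal.coe_nonneg t)]
  exact Set.disjoint_left.2 fun x hx hx' => not_lt.2 hx' hx.2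

theorem exists_glue (t : ℝ≥0) (f : L2 𝔨 (Set.Ico 0 (t : ℝ))) (g : L2 𝔨 (Set.Ici (t : ℝ))) :
    ∃ k : L2 𝔨 (Set.Ici 0), restrictL2 (pastSet_subset t) k = f ∧
      restrictL2 (futureSet_subset t) k = g := by
  have hr1 : (volume.restrict (Set.Ici (0 : ℝ))).restrict (Set.Ico 0 (t : ℝ)) =
      volume.restrict (Set.Ico 0 (t : ℝ)) :=
    Measure.restrict_restrict_of_subset (pastSet_subset t)
  have hr2 : (volume.restrict (Set.Ici (0 : ℝ))).restrict (Set.Ici (t : ℝ)) =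
      volume.restrict (Set.Ici (t : ℝ)) :=
    Measure.restrict_restrict_of_subset (futureSet_subset t)
  have h1 : MemLp ((Set.Ico 0 (t : ℝ)).indicator f) 2 (volume.restrict (Set.Ici 0)) := by
    rw [memLp_indicator_iff_restrict measurableSet_Ico, hr1]; exact Lp.memLp f
  have h2 : MemLp ((Set.Ici (t : ℝ)).indicator g) 2 (volume.restrict (Set.Ici 0)) := by
    rw [memLp_indicator_iff_restrict measurableSet_Ici, hr2]; exact Lp.memLp g
  have hk := MemLp.coeFn_toLp (h1.add h2)
  refine ⟨MemLp.toLp _ (h1.add h2), ?_, ?_⟩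
  · refine Lp.ext ?_
    filter_upwards [restrictL2_ae (pastSet_subset t) (MemLp.toLp _ (h1.add h2)),
      ae_mono (Measure.restrict_mono (pastSet_subset t) le_rfl) hk,
      ae_restrict_mem measurableSet_Ico] with x hx hx' hm
    rw [hx, hx', Pi.add_apply, Set.indicator_of_mem hm, Set.indicator_of_notMem, add_zero]
    exact fun h => not_lt.2 h hm.2
  · refine Lp.ext ?_
    filter_upwards [restrictL2_ae (futureSet_subset t) (MemLp.toLp _ (h1.add h2)),
      ae_mono (Measure.restrict_mono (futureSet_subset t) le_rfl) hk,
      ae_restrict_mem measurableSet_Ici] with x hx hx' hm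
    rw [hx, hx', Pi.add_apply, Set.indicator_of_mem hm, Set.indicator_of_notMem, zero_add]
    exact fun h => not_lt.2 hm h.2

section Split

variable (𝔥 : Type u) [NormedAddCommGroup 𝔥] [InnerProductSpace ℂ 𝔥] [CompleteSpace 𝔥]
variable (𝔨)

theorem splitTarget_total (t : ℝ≥0) :
    IsTotal fun p : 𝔥 × L2 𝔨 (Set.Ici 0) =>
      htmul (htmul p.1 (expVec (restrictL2 (pastSet_subset t) p.2)))
        (expVec (restrictL2 (futureSet_subset t) p.2)) := by
  have h2 : IsTotal fun p : (𝔥 × L2 𝔨 (Set.Ico 0 (t : ℝ))) × L2 𝔨 (Set.Ici (t : ℝ)) =>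
      htmul (htmul p.1.1 (expVec p.1.2)) (expVec p.2) := htmul_expVec_total
  refine isTotal_of_forall fun v hv => h2.eq_zero ?_
  rintro ⟨⟨u, f⟩, g⟩
  obtain ⟨k, hf, hg⟩ := exists_glue t f g
  have h3 := hv (u, k)
  simp only [hf, hg] at h3
  exact h3

/-- The unitary operator `u ⊗ e(f) ↦ (u ⊗ e(f|[0,t))) ⊗ e(f|[t,∞))` which implements the
identification of `𝔥 ⊗ Noise` with `𝔥 ⊗ NoisePast t ⊗ NoiseFuture t`. -/
def splitUnitary (t : ℝ≥0) : HTensor 𝔥 (Noise 𝔨) ≃ₗᵢ[ℂ]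
    HTensor (HTensor 𝔥 (NoisePast 𝔨 t)) (NoiseFuture 𝔨 t) :=
  gramUnitary (fun p : 𝔥 × L2 𝔨 (Set.Ici 0) => htmul p.1 (expVec p.2))
    (fun p => htmul (htmul p.1 (expVec (restrictL2 (pastSet_subset t) p.2)))
      (expVec (restrictL2 (futureSet_subset t) p.2)))
    (fun p q => by
      simp only [inner_htmul, inner_expVec]
      rw [inner_eq_restrict_add t, Complex.exp_add, mul_assoc])
    (htmul_total (x := (id : 𝔥 → 𝔥)) isTotal_id expVec_total)
    (splitTarget_total 𝔨 𝔥 t)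

variable {𝔨 𝔥}

/-- The operator on `𝔥 ⊗ Noise` identified with an operator on
`𝔥 ⊗ NoisePast t ⊗ NoiseFuture t`. -/
def join (t : ℝ≥0) (R : HTensor (HTensor 𝔥 (NoisePast 𝔨 t)) (NoiseFuture 𝔨 t) →L[ℂ]
      HTensor (HTensor 𝔥 (NoisePast 𝔨 t)) (NoiseFuture 𝔨 t)) :
    HTensor 𝔥 (Noise 𝔨) →L[ℂ] HTensor 𝔥 (Noise 𝔨) :=
  ((splitUnitary 𝔨 𝔥 t).symm.toContinuousLinearEquiv.toContinuousLinearMap.comp R).comp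
    (splitUnitary 𝔨 𝔥 t).toContinuousLinearEquiv.toContinuousLinearMap

/-- The operator `ξ ↦ ξ ⊗ Ω` from `𝔥 ⊗ NoisePast t` to `𝔥 ⊗ Noise`, where `Ω` is the vacuum
vector of `NoiseFuture t`. -/
def vacuumEmb (t : ℝ≥0) : HTensor 𝔥 (NoisePast 𝔨 t) →L[ℂ] HTensor 𝔥 (Noise 𝔨) :=
  (splitUnitary 𝔨 𝔥 t).symm.toContinuousLinearEquiv.toContinuousLinearMap.comp
    (ket _ (vacuum (L2 𝔨 (Set.Ici (t : ℝ)))))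

variable (𝔨 𝔥)

/-- The projection `P_t = 1 ⊗ |Ω⟩⟨Ω|` on `(𝔥 ⊗ NoisePast t) ⊗ NoiseFuture t = 𝔥 ⊗ Noise`. -/
def vacuumCond (t : ℝ≥0) : HTensor 𝔥 (Noise 𝔨) →L[ℂ] HTensor 𝔥 (Noise 𝔨) :=
  join t (opTensor (ContinuousLinearMap.id ℂ _) (vacuumProj (L2 𝔨 (Set.Ici (t : ℝ)))))

end Split

section Shift

theorem measurePreserving_sub (t : ℝ) :
    MeasurePreserving (fun x : ℝ => x - t) (volume.restrict (Set.Ici t))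
      (volume.restrict (Set.Ici 0)) := by
  have h := (measurePreserving_sub_right (volume : Measure ℝ) t).restrict_preimage
    (measurableSet_Ici (a := (0 : ℝ)))
  have e : (fun x : ℝ => x - t) ⁻¹' Set.Ici 0 = Set.Ici t := by
    ext x; simp
  rwa [e] at h

theorem measurePreserving_add (t : ℝ) :
    MeasurePreserving (fun x : ℝ => x + t) (volume.restrict (Set.Ici 0))
      (volume.restrict (Set.Ici t)) := by
  have h := (measurePreserving_add_right (volume : Measure ℝ) t).restrict_preimage
    (measurableSet_Ici (a := t))
  have e : (fun x : ℝ => x + t) ⁻¹' Set.Ici t = Set.Ici 0 := by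
    ext x; simp
  rwa [e] at h

variable (𝔨)

/-- The right shift `f ↦ f(· - t)` from `L²(ℝ₊; 𝔨)` onto `L²([t, ∞); 𝔨)`. -/
def shiftL2 (t : ℝ≥0) : L2 𝔨 (Set.Ici 0) ≃ₗᵢ[ℂ] L2 𝔨 (Set.Ici (t : ℝ)) :=
  LinearIsometryEquiv.ofSurjective
    (Lp.compMeasurePreservingₗᵢ ℂ (fun x : ℝ => x - t) (measurePreserving_sub (t : ℝ)))
    (fun g => by
      refine ⟨Lp.compMeasurePreserving (fun x : ℝ => x + t) (measurePreserving_add (t : ℝ)) g, ?_⟩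
      refine Lp.ext ?_
      have h1 := Lp.coeFn_compMeasurePreserving
        (Lp.compMeasurePreserving (fun x : ℝ => x + t) (measurePreserving_add (t : ℝ)) g)
        (measurePreserving_sub (t : ℝ))
      have h2 := (measurePreserving_sub (t : ℝ)).quasiMeasurePreserving.ae_eq_comp
        (Lp.coeFn_compMeasurePreserving g (measurePreserving_add (t : ℝ)))
      refine h1.trans (h2.trans (Filter.Eventually.of_forall fun x => ?_))
      simp)

/-- The second quantised shift `S_t`, a unitary operator from `Noise` onto `NoiseFuture t`. -/
def shiftFock (t : ℝ≥0) : Noise 𝔨 →L[ℂ] NoiseFuture 𝔨 t :=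
  (secondQuantisation (shiftL2 𝔨 t)).toContinuousLinearEquiv.toContinuousLinearMap

theorem shiftFock_adjoint_comp (t : ℝ≥0) :
    (ContinuousLinearMap.adjoint (shiftFock 𝔨 t)).comp (shiftFock 𝔨 t) =
      ContinuousLinearMap.id ℂ _ := by
  refine ContinuousLinearMap.ext fun x => ext_inner_left ℂ fun y => ?_
  rw [ContinuousLinearMap.comp_apply, ContinuousLinearMap.adjoint_inner_right]
  exact (secondQuantisation (shiftL2 𝔨 t)).inner_map_map y x

theorem shiftFock_comp_adjoint (t : ℝ≥0) :
    (shiftFock 𝔨 t).comp (ContinuousLinearMap.adjoint (shiftFock 𝔨 t)) =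
      ContinuousLinearMap.id ℂ _ := by
  refine ContinuousLinearMap.ext fun x => ?_
  obtain ⟨y, rfl⟩ := (secondQuantisation (shiftL2 𝔨 t)).surjective x
  exact congrArg (shiftFock 𝔨 t) (congrArg (fun T => T y) (shiftFock_adjoint_comp 𝔨 t))

variable {𝔨}
variable {𝔥 : Type u} [NormedAddCommGroup 𝔥] [InnerProductSpace ℂ 𝔥] [CompleteSpace 𝔥]

/-- The operator `(1 ⊗ S_t) T (1 ⊗ S_t)*`. -/
def shiftOp (t : ℝ≥0) (T : HTensor 𝔥 (Noise 𝔨) →L[ℂ] HTensor 𝔥 (Noise 𝔨)) :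
    HTensor 𝔥 (NoiseFuture 𝔨 t) →L[ℂ] HTensor 𝔥 (NoiseFuture 𝔨 t) :=
  ((opTensor (ContinuousLinearMap.id ℂ 𝔥) (shiftFock 𝔨 t)).comp T).comp
    (ContinuousLinearMap.adjoint (opTensor (ContinuousLinearMap.id ℂ 𝔥) (shiftFock 𝔨 t)))

theorem shiftOp_mem (A : VonNeumannAlgebra 𝔥) (t : ℝ≥0)
    {T : HTensor 𝔥 (Noise 𝔨) →L[ℂ] HTensor 𝔥 (Noise 𝔨)}
    (hT : T ∈ vnTensor A (boundedOps (Noise 𝔨))) :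
    shiftOp t T ∈ vnTensor A (boundedOps (NoiseFuture 𝔨 t)) := by
  set U := opTensor (ContinuousLinearMap.id ℂ 𝔥) (shiftFock 𝔨 t) with hU
  have hUa : ContinuousLinearMap.adjoint U =
      opTensor (ContinuousLinearMap.id ℂ 𝔥) (ContinuousLinearMap.adjoint (shiftFock 𝔨 t)) := by
    rw [hU, opTensor_adjoint]
    congr 1
    exact star_one (𝔥 →L[ℂ] 𝔥)
  have h1 : U.comp (ContinuousLinearMap.adjoint U) = ContinuousLinearMap.id ℂ _ := by
    rw [hUa, hU, opTensor_comp, shiftFock_comp_adjoint, ContinuousLinearMap.comp_id, opTensor_id]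
  have h1' : ∀ x, U (ContinuousLinearMap.adjoint U x) = x := fun x =>
    congrArg (fun S => S x) h1
  have h2' : ∀ x, ContinuousLinearMap.adjoint U (U x) = x := fun x => by
    have : (ContinuousLinearMap.adjoint U).comp U = ContinuousLinearMap.id ℂ _ := by
      rw [hUa, hU, opTensor_comp, shiftFock_adjoint_comp, ContinuousLinearMap.comp_id,
        opTensor_id]
    exact congrArg (fun S => S x) this
  refine (mem_vnTensor_iff _ _ _).2 fun c hc => ?_
  have h3 := (mem_vnTensor_iff _ _ _).1 hT
    (((ContinuousLinearMap.adjoint U).comp c).comp U) fun a ha b _ => by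
      have h4 := hc a ha (((shiftFock 𝔨 t).comp b).comp
        (ContinuousLinearMap.adjoint (shiftFock 𝔨 t))) (mem_boundedOps _)
      have h5 : opTensor a (((shiftFock 𝔨 t).comp b).comp
          (ContinuousLinearMap.adjoint (shiftFock 𝔨 t))) =
          (U.comp (opTensor a b)).comp (ContinuousLinearMap.adjoint U) := by
        rw [hUa, hU, opTensor_comp, opTensor_comp, ContinuousLinearMap.id_comp,
          ContinuousLinearMap.comp_id]
      rw [h5] at h4
      refine ContinuousLinearMap.ext fun x => ?_
      have h6 := congrArg (fun S => ContinuousLinearMap.adjoint U (S (U x))) h4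
      simpa [ContinuousLinearMap.mul_def, h1', h2'] using h6
  refine ContinuousLinearMap.ext fun x => ?_
  have h6 := congrArg (fun S => U (S (ContinuousLinearMap.adjoint U x))) h3
  simpa [ContinuousLinearMap.mul_def, shiftOp, ← hU, h1', h2'] using h6

/-- The map `σ_t : A ⊗ B(Noise) → A ⊗ B(NoiseFuture t)`, `T ↦ (1 ⊗ S_t) T (1 ⊗ S_t)*`. -/
def shiftMap (A : VonNeumannAlgebra 𝔥) (t : ℝ≥0) (T : vnTensor A (boundedOps (Noise 𝔨))) :
    vnTensor A (boundedOps (NoiseFuture 𝔨 t)) :=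
  ⟨shiftOp t T, shiftOp_mem A t T.2⟩

end Shift

end Noise

/-! ### Cocycles, flows and multipliers -/

section Cocycle

variable {𝔥 : Type u} [NormedAddCommGroup 𝔥] [InnerProductSpace ℂ 𝔥] [CompleteSpace 𝔥]
variable {𝔨 : Type v} [NormedAddCommGroup 𝔨] [InnerProductSpace ℂ 𝔨] [CompleteSpace 𝔨]

/-- The von Neumann algebra `A ⊗ B(Noise)`. -/
abbrev noiseAlg (A : VonNeumannAlgebra 𝔥) (𝔨 : Type v) [NormedAddCommGroup 𝔨]
    [InnerProductSpace ℂ 𝔨] [CompleteSpace 𝔨] : VonNeumannAlgebra (HTensor 𝔥 (Noise 𝔨)) :=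
  vnTensor A (boundedOps (Noise 𝔨))

variable {A : VonNeumannAlgebra 𝔥}

/-- The map `k_{t)} : a ↦ E^Ω k_t(a) E_Ω`, where `Ω` is the vacuum vector of `NoiseFuture t`. -/
def pastMap (t : ℝ≥0) (φ : A →ₗ[ℂ] noiseAlg A 𝔨) :
    A →ₗ[ℂ] (HTensor 𝔥 (NoisePast 𝔨 t) →L[ℂ] HTensor 𝔥 (NoisePast 𝔨 t)) :=
  compress (vacuumEmb t) (incl (noiseAlg A 𝔨) ∘ₗ φ)

/-- The map `J_t = (k_{t)} ⊗ id) ∘ σ_t` on `A ⊗ B(Noise)`, for `φ = k_t`. -/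
def cocycleExt (t : ℝ≥0) (φ : A →ₗ[ℂ] noiseAlg A 𝔨)
    (hφ : IsCompletelyBounded (incl (noiseAlg A 𝔨) ∘ₗ φ)) (T : noiseAlg A 𝔨) :
    HTensor 𝔥 (Noise 𝔨) →L[ℂ] HTensor 𝔥 (Noise 𝔨) :=
  join t (ampliation (pastMap t φ) (hφ.compress (vacuumEmb t)) (shiftMap A t T))

/-- Vacuum-adapted quantum stochastic cocycles on `A`. -/
structure VacuumAdaptedCocycle (A : VonNeumannAlgebra 𝔥) (𝔨 : Type v) [NormedAddCommGroup 𝔨]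
    [InnerProductSpace ℂ 𝔨] [CompleteSpace 𝔨] where
  /-- the maps `k_t` -/
  map : ℝ≥0 → (A →ₗ[ℂ] noiseAlg A 𝔨)
  normal : ∀ t, IsNormal (incl (noiseAlg A 𝔨) ∘ₗ map t)
  completelyBounded : ∀ t, IsCompletelyBounded (incl (noiseAlg A 𝔨) ∘ₗ map t)
  /-- `k_0(a) = a ⊗ |Ω⟩⟨Ω|` -/
  initial : ∀ a : A, (map 0 a : HTensor 𝔥 (Noise 𝔨) →L[ℂ] HTensor 𝔥 (Noise 𝔨)) =
    opTensor (a : 𝔥 →L[ℂ] 𝔥) (vacuumProj (L2 𝔨 (Set.Ici 0)))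
  /-- `k_t(a) = R ⊗ |Ω⟩⟨Ω|` for some `R ∈ A ⊗ B(NoisePast t)` -/
  adapted : ∀ (t : ℝ≥0) (a : A), ∃ R ∈ vnTensor A (boundedOps (NoisePast 𝔨 t)),
    (map t a : HTensor 𝔥 (Noise 𝔨) →L[ℂ] HTensor 𝔥 (Noise 𝔨)) =
      join t (opTensor R (vacuumProj (L2 𝔨 (Set.Ici (t : ℝ)))))
  /-- `k_{s + t} = (k_{s)} ⊗ id) ∘ σ_s ∘ k_t` -/
  cocycle : ∀ (s t : ℝ≥0) (a : A),
    (map (s + t) a : HTensor 𝔥 (Noise 𝔨) →L[ℂ] HTensor 𝔥 (Noise 𝔨)) =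
      cocycleExt s (map s) (completelyBounded s) (map t a)
  /-- `t ↦ k_t(a)` is ultraweakly continuous -/
  continuous : ∀ a : A, @Continuous ℝ≥0 (HTensor 𝔥 (Noise 𝔨) →L[ℂ] HTensor 𝔥 (Noise 𝔨)) _
    (ultraweak (HTensor 𝔥 (Noise 𝔨))) fun t => map t a

/-- Vacuum-adapted quantum stochastic flows on `A`: cocycles for which each map `k_{t)}` is a
unital `*`-homomorphism. -/
structure VacuumAdaptedFlow (A : VonNeumannAlgebra 𝔥) (𝔨 : Type v) [NormedAddCommGroup 𝔨]
    [InnerProductSpace ℂ 𝔨] [CompleteSpace 𝔨] extends VacuumAdaptedCocycle A 𝔨 where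
  past_one : ∀ t, pastMap t (map t) 1 = 1
  past_mul : ∀ (t : ℝ≥0) (a b : A),
    pastMap t (map t) (a * b) = pastMap t (map t) a * pastMap t (map t) b
  past_star : ∀ (t : ℝ≥0) (a : A), pastMap t (map t) (star a) = star (pastMap t (map t) a)

/-- The map `J_t = (j_{t)} ⊗ id) ∘ σ_t` of a flow `j`. -/
def VacuumAdaptedFlow.ext (j : VacuumAdaptedFlow A 𝔨) (t : ℝ≥0) (T : noiseAlg A 𝔨) :
    HTensor 𝔥 (Noise 𝔨) →L[ℂ] HTensor 𝔥 (Noise 𝔨) :=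
  cocycleExt t (j.map t) (j.completelyBounded t) T

/-- Multipliers for a vacuum-adapted quantum stochastic flow. -/
structure IsMultiplier (j : VacuumAdaptedFlow A 𝔨) (M : ℝ≥0 → noiseAlg A 𝔨) : Prop where
  zero : M 0 = 1
  commute : ∀ t : ℝ≥0,
    (M t : HTensor 𝔥 (Noise 𝔨) →L[ℂ] HTensor 𝔥 (Noise 𝔨)) * vacuumCond 𝔨 𝔥 t =
      vacuumCond 𝔨 𝔥 t * (M t : HTensor 𝔥 (Noise 𝔨) →L[ℂ] HTensor 𝔥 (Noise 𝔨))
  cocycle : ∀ s t : ℝ≥0,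
    (M (s + t) : HTensor 𝔥 (Noise 𝔨) →L[ℂ] HTensor 𝔥 (Noise 𝔨)) =
      j.ext s (M t) * (M s : HTensor 𝔥 (Noise 𝔨) →L[ℂ] HTensor 𝔥 (Noise 𝔨))
  continuous : ∀ ξ : HTensor 𝔥 (Noise 𝔨), Continuous fun t =>
    (M t : HTensor 𝔥 (Noise 𝔨) →L[ℂ] HTensor 𝔥 (Noise 𝔨)) ξ

/-- The vacuum expectation `𝔼 = id ⊗ ω_Ω : A ⊗ B(Noise) → A`, `T ↦ E^Ω T E_Ω`. -/
def vacuumExp (A : VonNeumannAlgebra 𝔥) (𝔨 : Type v) [NormedAddCommGroup 𝔨]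
    [InnerProductSpace ℂ 𝔨] [CompleteSpace 𝔨] : noiseAlg A 𝔨 →ₗ[ℂ] A :=
  sliceMap A (boundedOps (Noise 𝔨)) (vacuum _) (vacuum _)

/-- The map `a ↦ 𝔼[M_t* j_t(a) N_t]` on `A`. -/
def feynmanKac (j : VacuumAdaptedFlow A 𝔨) (M N : ℝ≥0 → noiseAlg A 𝔨) (t : ℝ≥0) : A →ₗ[ℂ] A where
  toFun a := vacuumExp A 𝔨 (star (M t) * j.map t a * N t)
  map_add' a b := by rw [map_add, mul_add, add_mul, map_add]
  map_smul' c a := by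
    have h : star (M t) * j.map t (c • a) * N t = c • (star (M t) * j.map t a * N t) := by
      refine Subtype.ext ?_
      rw [map_smul]
      change ((star (M t) : noiseAlg A 𝔨) : HTensor 𝔥 (Noise 𝔨) →L[ℂ] HTensor 𝔥 (Noise 𝔨)) *
        (c • (j.map t a : HTensor 𝔥 (Noise 𝔨) →L[ℂ] HTensor 𝔥 (Noise 𝔨))) * (N t) =
        c • (((star (M t) : noiseAlg A 𝔨) : HTensor 𝔥 (Noise 𝔨) →L[ℂ] HTensor 𝔥 (Noise 𝔨)) *
        (j.map t a) * (N t))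
      rw [mul_smul_comm, smul_mul_assoc]
    rw [h, map_smul, RingHom.id_apply]

end Cocycle

end QStoch

end

/-! Write `V` for the isometry `ξ ↦ ξ ⊗ Ω` from `𝔥 ⊗ NoisePast t` to `𝔥 ⊗ Noise` (`vacuumEmb`), so
that `P_t = V V*`, and `E_Ω` for `u ↦ u ⊗ Ω`. Adaptedness gives `j_t(a) = V j_{t)}(a) V*`
(`VacuumAdaptedFlow.map_eq`), and `𝒫_t(a) = (M_t E_Ω)* j_t(a) (N_t E_Ω)` (`coe_feynmanKac`). Each
`𝒫_t` is thus a two-sided compression of a normal map, which is itself the compression of a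
`*`-homomorphism by a contraction. Normality, the completely bounded estimate `‖M_t‖ ‖N_t‖`, and
complete positivity for `M = N` follow, once `*`-homomorphisms are known to be completely
contractive and completely positive.

The semigroup law rests on two properties of `J_s`. It is multiplicative and `*`-preserving
(`VacuumAdaptedFlow.ext_mul`, `VacuumAdaptedFlow.ext_star`), so the cocycle identities of `j`, `M`
and `N` combine to `M_{s+t}* j_{s+t}(a) N_{s+t} = M_s* J_s(M_t* j_t(a) N_t) N_s`. Moreover `P_s
J_s(T) P_s = j_s(𝔼[T])` (`VacuumAdaptedFlow.vacuumCond_ext`). As `P_s` fixes the vectors `u ⊗ Ω` and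
commutes with `M_s` and `N_s`, the vacuum expectation does not change when `J_s(T)` is replaced by
`P_s J_s(T) P_s` (`slice_vacuum_conj`), and what remains is `𝒫_s(𝒫_t(a))`.

Multiplicativity of `J_s` is the delicate point, because an ampliation is known only through its
slices. A slice of a product is an ultraweakly convergent sum of products of slices over a Hilbert
basis (`tendsto_sum_slice_mul`), and a normal multiplicative map respects such sums
(`ampliation_mul`).

For continuity in time, Banach–Steinhaus makes strongly continuous families locally bounded; weak
convergence of `𝒫_r(a)` then follows from strong convergence of the outer factors and weak
convergence of the middle one, and for bounded nets weak convergence is ultraweak convergence. -/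

noncomputable section

namespace QStoch

open Filter Topology

universe u v w

/-! ### The ultraweak topology and normal maps. -/

section Ultraweak

variable {H : Type u} {K : Type v} [NormedAddCommGroup H] [InnerProductSpace ℂ H]
  [NormedAddCommGroup K] [InnerProductSpace ℂ K]

theorem tendsto_ultraweak_iff {α : Type*} {l : Filter α} {f : α → H →L[ℂ] H} {T : H →L[ℂ] H} :
    Tendsto f l (@nhds _ (ultraweak H) T) ↔
      ∀ x y : lp (fun _ : ℕ => H) 2,
        Tendsto (fun i => ∑' n, inner ℂ (x n) (f i (y n))) l (𝓝 (∑' n, inner ℂ (x n) (T (y n)))) := by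
  rw [nhds_induced, tendsto_comap_iff, tendsto_pi_nhds, Prod.forall]
  rfl

/-- Sequences concentrated at index `0` are among those defining the topology. Uniqueness of
ultraweak limits is always obtained through these weak limits. -/
theorem Tendsto.inner_of_ultraweak {α : Type*} {l : Filter α} {f : α → H →L[ℂ] H} {T : H →L[ℂ] H}
    (h : Tendsto f l (@nhds _ (ultraweak H) T)) (u v : H) :
    Tendsto (fun i => inner ℂ u (f i v)) l (𝓝 (inner ℂ u (T v))) := by
  have e : ∀ S : H →L[ℂ] H, ∑' n, inner ℂ ((lp.single 2 0 u : lp (fun _ : ℕ => H) 2) n)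
      (S ((lp.single 2 0 v : lp (fun _ : ℕ => H) 2) n)) = inner ℂ u (S v) := fun S => by
    rw [tsum_eq_single 0]
    · simp
    · intro n hn
      simp [hn]
  simpa only [e] using tendsto_ultraweak_iff.1 h (lp.single 2 0 u) (lp.single 2 0 v)

/-- The image of a square-summable sequence under a bounded operator. -/
def mapSeq (X : H →L[ℂ] K) (x : lp (fun _ : ℕ => H) 2) : lp (fun _ : ℕ => K) 2 :=
  ⟨fun n => X (x n), by
    refine memℓp_gen ?_
    have h := (lp.memℓp x).summable (by norm_num)
    refine Summable.of_nonneg_of_le (fun n => by positivity) (fun n => ?_)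
      (h.mul_left (‖X‖ ^ (2 : ENNReal).toReal))
    rw [← Real.mul_rpow (norm_nonneg _) (norm_nonneg _)]
    exact Real.rpow_le_rpow (norm_nonneg _) (X.le_opNorm _) (by norm_num)⟩

@[simp] theorem mapSeq_apply (X : H →L[ℂ] K) (x : lp (fun _ : ℕ => H) 2) (n : ℕ) :
    mapSeq X x n = X (x n) := rfl

/-- The functional given by `(x, y)` pulls back to the one given by `(X x, Y y)`, and
square-summability survives a bounded operator. Two different operators are allowed, because the two
multipliers may differ. -/
theorem continuous_conj_ultraweak [CompleteSpace H] [CompleteSpace K] (X Y : H →L[ℂ] K) :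
    @Continuous (K →L[ℂ] K) (H →L[ℂ] H) (ultraweak K) (ultraweak H)
      fun T => (ContinuousLinearMap.adjoint X).comp (T.comp Y) := by
  refine (@continuous_iff_continuousAt _ _ (ultraweak K) (ultraweak H) _).2 fun T =>
    tendsto_ultraweak_iff.2 fun x y => ?_
  have h := (tendsto_ultraweak_iff (f := id) (l := @nhds _ (ultraweak K) T) (T := T)).1
    tendsto_id (mapSeq X x) (mapSeq Y y)
  simpa [ContinuousLinearMap.adjoint_inner_right] using h

theorem summable_norm_mul_norm (x y : lp (fun _ : ℕ => H) 2) :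
    Summable fun n => ‖x n‖ * ‖y n‖ := by
  have hx := (lp.memℓp x).summable (by norm_num)
  have hy := (lp.memℓp y).summable (by norm_num)
  have h2 : (2 : ENNReal).toReal = (2 : ℕ) := by norm_num
  simp only [h2, Real.rpow_natCast] at hx hy
  -- Comparison with `‖x n‖² + ‖y n‖²`, by the arithmetic-geometric mean inequality.
  exact Summable.of_nonneg_of_le (fun n => by positivity)
    (fun n => by nlinarith [sq_nonneg (‖x n‖ - ‖y n‖), sq_nonneg (‖x n‖), sq_nonneg (‖y n‖)])
    (hx.add hy)

/-- A bounded net of operators which converges weakly converges ultraweakly. -/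
theorem tendsto_ultraweak_of_bounded {α : Type*} {l : Filter α} {f : α → H →L[ℂ] H}
    {T : H →L[ℂ] H} {C : ℝ} (hC : ∀ᶠ i in l, ‖f i‖ ≤ C)
    (h : ∀ u v, Tendsto (fun i => inner ℂ u (f i v)) l (𝓝 (inner ℂ u (T v)))) :
    Tendsto f l (@nhds _ (ultraweak H) T) := by
  refine tendsto_ultraweak_iff.2 fun x y => ?_
  -- Each term converges by weak convergence; the bound on the net supplies the summable majorant `C
  -- ‖x n‖ ‖y n‖`.
  refine tendsto_tsum_of_dominated_convergence ((summable_norm_mul_norm x y).mul_left C)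
    (fun n => h _ _) ?_
  filter_upwards [hC] with i hi n
  calc ‖inner ℂ (x n) (f i (y n))‖ ≤ ‖x n‖ * (‖f i‖ * ‖y n‖) :=
        (norm_inner_le_norm _ _).trans (by gcongr; exact (f i).le_opNorm _)
    _ ≤ ‖x n‖ * (C * ‖y n‖) := by gcongr
    _ = C * (‖x n‖ * ‖y n‖) := by ring

theorem IsNormal.tendsto [CompleteSpace H] {A : VonNeumannAlgebra H} {φ : A →ₗ[ℂ] (K →L[ℂ] K)}
    (hφ : IsNormal φ) {α : Type*} {l : Filter α} {f : α → A} {a : A}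
    (h : Tendsto (fun i => (f i : H →L[ℂ] H)) l (@nhds _ (ultraweak H) a)) :
    Tendsto (fun i => φ (f i)) l (@nhds _ (ultraweak K) (φ a)) := by
  have h1 := @Continuous.tendsto _ _ (TopologicalSpace.induced Subtype.val (ultraweak H))
    (ultraweak K) _ hφ a
  refine h1.comp ?_
  rw [@nhds_induced _ _ (ultraweak H) Subtype.val a, tendsto_comap_iff]
  exact h

/-- The compressed map enters as any `ψ` with the stated factorisation, so that the lemma serves
both `pastMap` and `feynmanKac`, where the two outer operators differ. -/
theorem IsNormal.conj {L : Type w} [NormedAddCommGroup L] [InnerProductSpace ℂ L] [CompleteSpace H]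
    [CompleteSpace K] [CompleteSpace L] {A : VonNeumannAlgebra H} {φ : A →ₗ[ℂ] (K →L[ℂ] K)}
    (hφ : IsNormal φ) (X Y : L →L[ℂ] K) {ψ : A →ₗ[ℂ] (L →L[ℂ] L)}
    (hψ : ∀ a, ψ a = (ContinuousLinearMap.adjoint X).comp ((φ a).comp Y)) : IsNormal ψ := by
  have e : (ψ : A → L →L[ℂ] L) =
      (fun T => (ContinuousLinearMap.adjoint X).comp (T.comp Y)) ∘ φ := funext hψ
  unfold IsNormal
  rw [e]
  exact @Continuous.comp _ _ _ (TopologicalSpace.induced Subtype.val (ultraweak H))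
    (ultraweak K) (ultraweak L) _ _ (continuous_conj_ultraweak X Y) hφ

end Ultraweak

/-! ### Matrix lifts and `*`-homomorphisms. -/

section Matrix

variable {H : Type u} {K : Type v} [NormedAddCommGroup H] [InnerProductSpace ℂ H]
  [NormedAddCommGroup K] [InnerProductSpace ℂ K]

theorem norm_toLp_map_le {n : ℕ} (X : H →L[ℂ] K) (f : PiLp 2 (fun _ : Fin n => H)) :
    ‖(WithLp.toLp 2 fun i => X (f i) : PiLp 2 (fun _ : Fin n => K))‖ ≤ ‖X‖ * ‖f‖ := by
  refine (sq_le_sq₀ (norm_nonneg _) (by positivity)).1 ?_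
  rw [PiLp.norm_sq_eq_of_L2, mul_pow, PiLp.norm_sq_eq_of_L2, Finset.mul_sum]
  refine Finset.sum_le_sum fun i _ => ?_
  rw [← mul_pow]
  exact pow_le_pow_left₀ (norm_nonneg _) (X.le_opNorm _) 2

variable [CompleteSpace H] [CompleteSpace K]

/-- The matrix with entries `X* a i j Y` is the compression of `matOp a` by the diagonal operators
`X ⊕ ⋯ ⊕ X` and `Y ⊕ ⋯ ⊕ Y`. Both the norm estimate and the preservation of positivity come from
this. -/
theorem inner_matOp_conj {n : ℕ} (X Y : H →L[ℂ] K) (a : Fin n → Fin n → (K →L[ℂ] K))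
    (f g : PiLp 2 (fun _ : Fin n => H)) :
    inner ℂ f (matOp (fun i j => (ContinuousLinearMap.adjoint X).comp ((a i j).comp Y)) g) =
      inner ℂ (WithLp.toLp 2 fun i => X (f i) : PiLp 2 (fun _ : Fin n => K))
        (matOp a (WithLp.toLp 2 fun i => Y (g i))) := by
  simp [inner_matOp, ContinuousLinearMap.adjoint_inner_right]

theorem norm_matOp_conj_le {n : ℕ} (X Y : H →L[ℂ] K) (a : Fin n → Fin n → (K →L[ℂ] K)) :
    ‖matOp (fun i j => (ContinuousLinearMap.adjoint X).comp ((a i j).comp Y))‖ ≤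
      ‖X‖ * ‖Y‖ * ‖matOp a‖ := by
  refine norm_le_of_inner _ (by positivity) fun f g => ?_
  rw [inner_matOp_conj]
  calc _ ≤ ‖(WithLp.toLp 2 fun i => X (f i) : PiLp 2 (fun _ : Fin n => K))‖ *
        ‖matOp a (WithLp.toLp 2 fun i => Y (g i))‖ := norm_inner_le_norm _ _
    _ ≤ (‖X‖ * ‖f‖) * (‖matOp a‖ * (‖Y‖ * ‖g‖)) := by
        gcongr
        · exact norm_toLp_map_le X f
        · exact ((matOp a).le_opNorm _).trans (by gcongr; exact norm_toLp_map_le Y g)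
    _ = _ := by ring

theorem isPositive_matOp_conj {n : ℕ} (X : H →L[ℂ] K) {a : Fin n → Fin n → (K →L[ℂ] K)}
    (ha : (matOp a).IsPositive) :
    (matOp (fun i j => (ContinuousLinearMap.adjoint X).comp ((a i j).comp X))).IsPositive := by
  rw [ContinuousLinearMap.isPositive_iff_complex] at ha ⊢
  intro f
  have h := ha (WithLp.toLp 2 fun i => X (f i))
  -- The positivity criterion has the operator in the first slot of the inner product,
  -- `inner_matOp_conj` in the second.
  rw [← inner_conj_symm] at h ⊢
  rwa [inner_matOp_conj]

/-- The action of matrices over a represented algebra on `K ⊕ ⋯ ⊕ K`. -/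
def matRep {A : Type*} [CStarAlgebra A] (π : A →⋆ₐ[ℂ] (K →L[ℂ] K)) (n : ℕ) :
    CStarMatrix (Fin n) (Fin n) A →⋆ₐ[ℂ] (PiLp 2 (fun _ : Fin n => K) →L[ℂ] PiLp 2 (fun _ : Fin n => K)) where
  toFun a := matOp fun i j => π (a i j)
  map_one' := by
    ext f i
    simp only [matOp_apply, CStarMatrix.one_apply, apply_ite π, map_one, map_zero]
    rw [Finset.sum_eq_single i]
    · simp
    · intro j _ hj; simp [hj.symm]
    · simp
  map_mul' a b := by
    ext f i
    simp only [matOp_apply, CStarMatrix.mul_apply, map_sum, map_mul, mul_apply_eq_comp,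
      sum_apply]
    exact Finset.sum_comm
  map_zero' := by
    ext f i
    simp [matOp_apply]
  map_add' a b := by
    ext f i
    simp [matOp_apply, Finset.sum_add_distrib]
  commutes' c := by
    ext f i
    simp only [matOp_apply, CStarMatrix.algebraMap_apply, apply_ite π, map_zero]
    rw [Finset.sum_eq_single i]
    · simp [Algebra.algebraMap_eq_smul_one]
    · intro j _ hj; simp [hj.symm]
    · simp
  map_star' a := by
    refine ContinuousLinearMap.ext fun g => ext_inner_left ℂ fun f => ?_
    rw [ContinuousLinearMap.star_eq_adjoint, ContinuousLinearMap.adjoint_inner_right, inner_matOp]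
    simp only [PiLp.inner_apply, matOp_apply, sum_inner]
    rw [Finset.sum_comm]
    refine Finset.sum_congr rfl fun i _ => Finset.sum_congr rfl fun j _ => ?_
    rw [← ContinuousLinearMap.adjoint_inner_right, ← ContinuousLinearMap.star_eq_adjoint,
      ← map_star]
    rfl

theorem matOp_injective {n : ℕ} {a b : Fin n → Fin n → (H →L[ℂ] H)} (h : matOp a = matOp b) :
    a = b := by
  funext i j
  ext v
  have := congrArg (fun T => T (PiLp.single 2 j v) i) h
  simpa [matOp_apply, Pi.single_apply, apply_ite] using this

theorem matRep_injective {A : Type*} [CStarAlgebra A] {π : A →⋆ₐ[ℂ] (K →L[ℂ] K)}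
    (hπ : Function.Injective π) (n : ℕ) : Function.Injective (matRep π n) := by
  intro a b h
  have h' := matOp_injective h
  ext i j
  exact hπ (congrFun (congrFun h' i) j)

/-- A von Neumann algebra is its own bicommutant, and centralizers are norm closed. Closedness is
what makes it a C*-algebra, hence gives its matrices a C*-structure. -/
theorem isClosed_coe (A : VonNeumannAlgebra H) : IsClosed (A : Set (H →L[ℂ] H)) := by
  rw [← A.centralizer_centralizer]
  exact Set.isClosed_centralizer _

instance (A : VonNeumannAlgebra H) : CStarAlgebra A :=
  StarSubalgebra.cstarAlgebra A (h_closed := isClosed_coe A)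

/-- The identity representation of a von Neumann algebra. -/
def inclHom (A : VonNeumannAlgebra H) : A →⋆ₐ[ℂ] (H →L[ℂ] H) where
  toFun a := a
  map_one' := rfl
  map_mul' _ _ := rfl
  map_zero' := rfl
  map_add' _ _ := rfl
  commutes' _ := rfl
  map_star' _ := rfl

theorem inclHom_injective (A : VonNeumannAlgebra H) : Function.Injective (inclHom A) :=
  Subtype.val_injective

/-- Both matrix operators represent the same element of the C*-algebra of matrices over `A`. The
identity representation is injective on matrices, hence isometric, while the one induced by `π` is
contractive. -/
theorem norm_matOp_starHom_le (A : VonNeumannAlgebra H) (π : A →⋆ₐ[ℂ] (K →L[ℂ] K)) {n : ℕ}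
    (a : Fin n → Fin n → A) :
    ‖matOp fun i j => π (a i j)‖ ≤ ‖matOp fun i j => (a i j : H →L[ℂ] H)‖ := by
  -- The C*-structure on matrices takes an order on `A` as data; the spectral order supplies it.
  let _ : PartialOrder A := CStarAlgebra.spectralOrder A
  have : StarOrderedRing A := CStarAlgebra.spectralOrderedRing A
  let b : CStarMatrix (Fin n) (Fin n) A := CStarMatrix.ofMatrix (Matrix.of a)
  change ‖matRep π n b‖ ≤ ‖matRep (inclHom A) n b‖
  rw [NonUnitalStarAlgHom.norm_map (matRep (inclHom A) n)
    (matRep_injective (inclHom_injective A) n) b]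
  exact NonUnitalStarAlgHom.norm_apply_le _ _

/-- Injectivity reflects self-adjointness, and an injective `*`-homomorphism preserves the real
spectrum of a self-adjoint element. -/
theorem nonneg_of_map_nonneg {B C : Type*} [CStarAlgebra B] [PartialOrder B] [StarOrderedRing B]
    [CStarAlgebra C] [PartialOrder C] [StarOrderedRing C] (φ : B →⋆ₐ[ℂ] C)
    (hφ : Function.Injective φ) {b : B} (h : 0 ≤ φ b) : 0 ≤ b := by
  have hsa : IsSelfAdjoint b := hφ (by rw [map_star]; exact h.isSelfAdjoint)
  rw [StarOrderedRing.nonneg_iff_spectrum_nonneg (R := ℝ) b hsa, ← hsa.map_spectrum_real φ hφ]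
  exact fun x hx => spectrum_nonneg_of_nonneg h hx

/-- Positivity of the operator matrix is pulled back along the faithful identity representation to
positivity in the C*-algebra of matrices, which does not depend on a representation, and is then
pushed forward by `π`. -/
theorem isPositive_matOp_starHom (A : VonNeumannAlgebra H) (π : A →⋆ₐ[ℂ] (K →L[ℂ] K)) {n : ℕ}
    (a : Fin n → Fin n → A) (ha : (matOp fun i j => (a i j : H →L[ℂ] H)).IsPositive) :
    (matOp fun i j => π (a i j)).IsPositive := by
  let _ : PartialOrder A := CStarAlgebra.spectralOrder A
  have : StarOrderedRing A := CStarAlgebra.spectralOrderedRing A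
  let b : CStarMatrix (Fin n) (Fin n) A := CStarMatrix.ofMatrix (Matrix.of a)
  change (matRep (inclHom A) n b).IsPositive at ha
  change (matRep π n b).IsPositive
  rw [← ContinuousLinearMap.nonneg_iff_isPositive] at ha ⊢
  have hb : 0 ≤ b :=
    nonneg_of_map_nonneg (matRep (inclHom A) n) (matRep_injective (inclHom_injective A) n) ha
  exact map_nonneg (matRep π n) hb

end Matrix

/-! ### Slices of products, and multiplicativity of ampliations. -/

section SliceProduct

variable {H : Type u} {K : Type v} {L : Type w} [NormedAddCommGroup H] [InnerProductSpace ℂ H]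
  [NormedAddCommGroup K] [InnerProductSpace ℂ K] [NormedAddCommGroup L] [InnerProductSpace ℂ L]
  [CompleteSpace H] [CompleteSpace K] [CompleteSpace L]

theorem adjoint_ket_htmul (x : K) (u : H) (y : K) :
    ContinuousLinearMap.adjoint (ket H x) (htmul u y) = inner ℂ x y • u := by
  refine ext_inner_left ℂ fun v => ?_
  rw [ContinuousLinearMap.adjoint_inner_right, ket_apply, inner_htmul, inner_smul_right, mul_comm]

/-- The operator `1 ⊗ p`, with `p` the projection onto the span of the `e k` for `k ∈ F`. -/
def partialProj (H : Type u) [NormedAddCommGroup H] [InnerProductSpace ℂ H] [CompleteSpace H]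
    {κ : Type*} (e : κ → K) (F : Finset κ) : HTensor H K →L[ℂ] HTensor H K :=
  ∑ k ∈ F, (ket H (e k)).comp (ContinuousLinearMap.adjoint (ket H (e k)))

theorem inner_partialProj {κ : Type*} (e : κ → K) (F : Finset κ) (η ζ : HTensor H K) :
    inner ℂ η (partialProj H e F ζ) = ∑ k ∈ F,
      inner ℂ (ContinuousLinearMap.adjoint (ket H (e k)) η)
        (ContinuousLinearMap.adjoint (ket H (e k)) ζ) := by
  simp only [partialProj, sum_apply, inner_sum, ContinuousLinearMap.comp_apply]
  exact Finset.sum_congr rfl fun k _ => (ContinuousLinearMap.adjoint_inner_left _ _ _).symm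

theorem partialProj_htmul {κ : Type*} (e : κ → K) (F : Finset κ) (u : H) (x : K) :
    partialProj H e F (htmul u x) = htmul u (∑ k ∈ F, inner ℂ (e k) x • e k) := by
  simp only [partialProj, sum_apply, ContinuousLinearMap.comp_apply, adjoint_ket_htmul, map_smul,
    ket_apply]
  rw [← leftKet_apply, map_sum]
  simp

theorem partialProj_idem {κ : Type*} {e : κ → K} (he : Orthonormal ℂ e) (F : Finset κ)
    (ζ : HTensor H K) : partialProj H e F (partialProj H e F ζ) = partialProj H e F ζ := by
  have h : (partialProj H e F).comp (partialProj H e F) = partialProj H e F := by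
    refine htensor_ext fun u x => ?_
    rw [ContinuousLinearMap.comp_apply, partialProj_htmul, partialProj_htmul]
    congr 1
    refine Finset.sum_congr rfl fun k hk => ?_
    rw [he.inner_right_sum _ hk]
  exact congrArg (fun T => T ζ) h

/-- The operator is a self-adjoint idempotent, so `‖Q ζ‖² = ⟪ζ, Q ζ⟫ ≤ ‖ζ‖ ‖Q ζ‖`. What matters
later is that the bound is uniform in `F`. -/
theorem norm_partialProj_le {κ : Type*} {e : κ → K} (he : Orthonormal ℂ e) (F : Finset κ) :
    ‖partialProj H e F‖ ≤ 1 := by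
  refine ContinuousLinearMap.opNorm_le_bound _ zero_le_one fun ζ => ?_
  set Q := partialProj H e F with hQ
  have h1 : inner ℂ (Q ζ) (Q ζ) = inner ℂ ζ (Q ζ) := by
    have : inner ℂ (Q ζ) (Q ζ) = inner ℂ ζ (Q (Q ζ)) := by
      rw [← inner_conj_symm]
      nth_rewrite 2 [hQ]
      rw [inner_partialProj]
      nth_rewrite 1 [hQ]
      rw [inner_partialProj, map_sum]
      exact Finset.sum_congr rfl fun k _ => inner_conj_symm _ _
    rw [this, partialProj_idem he]
  have h2 : ‖Q ζ‖ ^ 2 ≤ ‖ζ‖ * ‖Q ζ‖ := by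
    have h3 := norm_inner_le_norm (𝕜 := ℂ) ζ (Q ζ)
    rw [← h1, inner_self_eq_norm_sq_to_K] at h3
    simpa using h3
  rcases (norm_nonneg (Q ζ)).eq_or_lt with h0 | h0
  · rw [← h0]; positivity
  · nlinarith

/-- On elementary tensors this is the basis expansion of the second factor. It passes to the
completion by density and the uniform bound `norm_partialProj_le`. -/
theorem tendsto_partialProj {κ : Type*} (e : HilbertBasis κ ℂ K) (ζ : HTensor H K) :
    Tendsto (fun F => partialProj H e F ζ) atTop (𝓝 ζ) := by
  have h1 : ∀ s : H ⊗[ℂ] K,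
      Tendsto (fun F => partialProj H e F (algEmb H K s)) atTop (𝓝 (algEmb H K s)) := by
    intro s
    induction s using TensorProduct.induction_on with
    | zero => simp
    | tmul u x =>
      change Tendsto (fun F => partialProj H e F (htmul u x)) atTop (𝓝 (htmul u x))
      simp only [partialProj_htmul]
      have h := e.hasSum_repr x
      simp only [HilbertBasis.repr_apply_apply] at h
      exact ((leftKet K u).continuous.tendsto x).comp h
    | add s t hs ht => simpa using hs.add ht
  rw [Metric.tendsto_nhds]
  intro ε hε
  obtain ⟨s, hs⟩ := Metric.denseRange_iff.1 (algEmb_denseRange (H := H) (K := K)) ζ (ε / 3)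
    (by positivity)
  filter_upwards [Metric.tendsto_nhds.1 (h1 s) (ε / 3) (by positivity)] with F hF
  have h2 : dist (partialProj H e F ζ) (partialProj H e F (algEmb H K s)) < ε / 3 := by
    rw [dist_eq_norm, ← map_sub]
    refine ((partialProj H e F).le_of_opNorm_le (norm_partialProj_le e.orthonormal F) _).trans_lt ?_
    rwa [one_mul, ← dist_eq_norm]
  have h3 := dist_triangle4 (partialProj H e F ζ) (partialProj H e F (algEmb H K s))
    (algEmb H K s) ζ
  rw [dist_comm] at hs
  linarith

/-- Ultraweak expansion of the slices of a product. -/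
theorem tendsto_sum_slice_mul {κ : Type*} (e : HilbertBasis κ ℂ K)
    (S T : HTensor H K →L[ℂ] HTensor H K) (x y : K) :
    Tendsto (fun F : Finset κ => ∑ k ∈ F, slice x (e k) S * slice (e k) y T) atTop
      (@nhds _ (ultraweak H) (slice x y (S * T))) := by
  -- The partial sum is the slice of the product with `1 ⊗ p_F` inserted in the middle, as `1 ⊗ |e
  -- k⟩⟨e k|` factors through the slicing operators.
  have h : ∀ F : Finset κ, ∑ k ∈ F, slice x (e k) S * slice (e k) y T =
      slice x y (S * partialProj H e F * T) := by
    intro F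
    ext v
    simp [slice, partialProj, sum_apply]
  simp only [h]
  -- The factor `1` bounds `1 ⊗ p_F` independently of `F`, so weak convergence is enough.
  refine tendsto_ultraweak_of_bounded (C := ‖S‖ * 1 * ‖T‖ * ‖x‖ * ‖y‖)
    (Eventually.of_forall fun F => ?_) fun u v => ?_
  · refine (norm_slice_le _ _ _).trans ?_
    gcongr
    refine (norm_mul_le _ _).trans ?_
    gcongr
    refine (norm_mul_le _ _).trans ?_
    gcongr
    exact norm_partialProj_le e.orthonormal F
  · simp only [inner_slice, mul_apply_eq_comp]
    exact tendsto_const_nhds.inner ((S.continuous.tendsto _).comp (tendsto_partialProj e _))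

/-- Amplifications of normal multiplicative maps are multiplicative. -/
theorem ampliation_mul {A : VonNeumannAlgebra H} {φ : A →ₗ[ℂ] (K →L[ℂ] K)}
    (hφ : IsCompletelyBounded φ) (hn : IsNormal φ) (hm : ∀ a b, φ (a * b) = φ a * φ b)
    (S T : vnTensor A (boundedOps L)) :
    ampliation φ hφ (S * T) = ampliation φ hφ S * ampliation φ hφ T := by
  obtain ⟨w, e, -⟩ := exists_hilbertBasis ℂ L
  refine slice_ext fun x y => ?_
  rw [slice_ampliation]
  -- The partial sums lie in `A`, so `φ` can be applied to them term by term before passing to the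
  -- limit.
  let f : Finset w → A := fun F => ∑ k ∈ F,
    sliceMap A (boundedOps L) x (e k) S * sliceMap A (boundedOps L) (e k) y T
  have h1 : Tendsto (fun F => (f F : H →L[ℂ] H)) atTop
      (@nhds _ (ultraweak H) (sliceMap A (boundedOps L) x y (S * T) : A)) := by
    have h := tendsto_sum_slice_mul e (S : HTensor H L →L[ℂ] HTensor H L) T x y
    refine h.congr fun F => ?_
    simp only [f, AddSubmonoidClass.coe_finsetSum]
    rfl
  -- Normality enters here: `φ` is carried through the infinite sum. The same net also converges to
  -- the slice of the product of the ampliations.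
  have h2 := hn.tendsto h1
  have h3 := tendsto_sum_slice_mul e (ampliation φ hφ S) (ampliation φ hφ T) x y
  have h4 : ∀ F, φ (f F) = ∑ k ∈ F, slice x (e k) (ampliation φ hφ S) *
      slice (e k) y (ampliation φ hφ T) := fun F => by
    simp only [f, map_sum, hm, slice_ampliation]
  simp only [← h4] at h3
  refine ContinuousLinearMap.ext fun v => ext_inner_left ℂ fun u => ?_
  exact tendsto_nhds_unique (Tendsto.inner_of_ultraweak h2 u v)
    (Tendsto.inner_of_ultraweak h3 u v)

theorem slice_star (x y : K) (T : HTensor H K →L[ℂ] HTensor H K) :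
    slice x y (star T) = star (slice y x T) := by
  simp [slice, ContinuousLinearMap.star_eq_adjoint, ContinuousLinearMap.adjoint_comp,
    ContinuousLinearMap.comp_assoc]

/-- Taking adjoints exchanges the two slicing vectors, so the identity holds slice by slice;
normality plays no part. -/
theorem ampliation_star {A : VonNeumannAlgebra H} {φ : A →ₗ[ℂ] (K →L[ℂ] K)}
    (hφ : IsCompletelyBounded φ) (hs : ∀ a, φ (star a) = star (φ a))
    (T : vnTensor A (boundedOps L)) :
    ampliation φ hφ (star T) = star (ampliation φ hφ T) := by
  refine slice_ext fun x y => ?_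
  rw [slice_star, slice_ampliation, slice_ampliation, ← hs]
  exact congrArg φ (Subtype.ext (slice_star _ _ _))

end SliceProduct

/-! ### The vacuum vector under the tensor splitting and the shift. -/

section Vacuum

variable {𝔥 : Type u} [NormedAddCommGroup 𝔥] [InnerProductSpace ℂ 𝔥] [CompleteSpace 𝔥]
variable {𝔨 : Type v} [NormedAddCommGroup 𝔨] [InnerProductSpace ℂ 𝔨] [CompleteSpace 𝔨]

theorem inner_vacuum (K : Type v) [NormedAddCommGroup K] [InnerProductSpace ℂ K] :
    inner ℂ (vacuum K) (vacuum K) = 1 := by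
  rw [vacuum, inner_expVec, inner_zero_left, Complex.exp_zero]

theorem norm_vacuum (K : Type v) [NormedAddCommGroup K] [InnerProductSpace ℂ K] :
    ‖vacuum K‖ = 1 := by
  rw [norm_eq_sqrt_re_inner (𝕜 := ℂ), inner_vacuum, RCLike.one_re, Real.sqrt_one]

theorem opTensor_vacuumProj {H : Type u} [NormedAddCommGroup H] [InnerProductSpace ℂ H]
    [CompleteSpace H] (K : Type v) [NormedAddCommGroup K] [InnerProductSpace ℂ K]
    (R : H →L[ℂ] H) : opTensor R (vacuumProj K) =
      (ket H (vacuum K)).comp (R.comp (ContinuousLinearMap.adjoint (ket H (vacuum K)))) := by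
  refine htensor_ext fun u x => ?_
  simp only [opTensor_htmul, vacuumProj, InnerProductSpace.rankOne_apply,
    ContinuousLinearMap.comp_apply, adjoint_ket_htmul, map_smul, ket_apply]
  rw [← leftKet_apply, map_smul, leftKet_apply]

theorem adjoint_ket_vacuum_comp_ket (H : Type u) [NormedAddCommGroup H] [InnerProductSpace ℂ H]
    [CompleteSpace H] (K : Type v) [NormedAddCommGroup K] [InnerProductSpace ℂ K] (u : H) :
    ContinuousLinearMap.adjoint (ket H (vacuum K)) (htmul u (vacuum K)) = u := by
  rw [adjoint_ket_htmul, inner_vacuum, one_smul]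

theorem adjoint_vacuumEmb_apply (t : ℝ≥0) (ζ : HTensor 𝔥 (Noise 𝔨)) :
    ContinuousLinearMap.adjoint (vacuumEmb (𝔥 := 𝔥) (𝔨 := 𝔨) t) ζ =
      ContinuousLinearMap.adjoint (ket _ (vacuum (L2 𝔨 (Set.Ici (t : ℝ)))))
        (splitUnitary 𝔨 𝔥 t ζ) := by
  refine ext_inner_left ℂ fun ξ => ?_
  rw [ContinuousLinearMap.adjoint_inner_right, ContinuousLinearMap.adjoint_inner_right]
  change inner ℂ ((splitUnitary 𝔨 𝔥 t).symm _) ζ = _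
  rw [← (splitUnitary 𝔨 𝔥 t).inner_map_map, LinearIsometryEquiv.apply_symm_apply]
  rfl

/-- The vacuum is a unit vector. This is what recovers `R` from an adapted operator `R ⊗ |Ω⟩⟨Ω|`. -/
theorem adjoint_vacuumEmb_vacuumEmb (t : ℝ≥0) (ξ : HTensor 𝔥 (NoisePast 𝔨 t)) :
    ContinuousLinearMap.adjoint (vacuumEmb (𝔥 := 𝔥) (𝔨 := 𝔨) t) (vacuumEmb t ξ) = ξ := by
  rw [adjoint_vacuumEmb_apply]
  change ContinuousLinearMap.adjoint _ (splitUnitary 𝔨 𝔥 t ((splitUnitary 𝔨 𝔥 t).symm _)) = ξ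
  rw [LinearIsometryEquiv.apply_symm_apply]
  exact adjoint_ket_vacuum_comp_ket _ _ ξ

/-- Since `1 ⊗ |Ω⟩⟨Ω|` factors as slicing followed by tensoring with `Ω`, an adapted operator is a
conjugate `V R V*`. Adaptedness and `P_t` are used in this form. -/
theorem join_opTensor_vacuumProj (t : ℝ≥0)
    (R : HTensor 𝔥 (NoisePast 𝔨 t) →L[ℂ] HTensor 𝔥 (NoisePast 𝔨 t)) :
    join t (opTensor R (vacuumProj (L2 𝔨 (Set.Ici (t : ℝ))))) =
      (vacuumEmb t).comp (R.comp (ContinuousLinearMap.adjoint (vacuumEmb t))) := by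
  refine ContinuousLinearMap.ext fun ζ => ?_
  rw [opTensor_vacuumProj]
  simp only [ContinuousLinearMap.comp_apply, adjoint_vacuumEmb_apply]
  rfl

theorem vacuumCond_eq (t : ℝ≥0) : vacuumCond 𝔨 𝔥 t =
    (vacuumEmb t).comp (ContinuousLinearMap.adjoint (vacuumEmb t)) := by
  rw [vacuumCond, join_opTensor_vacuumProj, ContinuousLinearMap.id_comp]

theorem star_vacuumCond (t : ℝ≥0) : star (vacuumCond 𝔨 𝔥 t) = vacuumCond 𝔨 𝔥 t := by
  rw [vacuumCond_eq, ContinuousLinearMap.star_eq_adjoint, ContinuousLinearMap.adjoint_comp,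
    ContinuousLinearMap.adjoint_adjoint]

theorem restrictL2_zero {J J' : Set ℝ} (h : J ⊆ J') : restrictL2 (𝔨 := 𝔨) h 0 = 0 := by
  refine Lp.ext ?_
  filter_upwards [restrictL2_ae h (0 : L2 𝔨 J'), Lp.coeFn_zero 𝔨 2 (volume.restrict J),
    ae_mono (Measure.restrict_mono h le_rfl) (Lp.coeFn_zero 𝔨 2 (volume.restrict J'))]
    with x h1 h2 h3
  rw [h1, h2, h3]

theorem splitUnitary_vacuum (t : ℝ≥0) (u : 𝔥) : splitUnitary 𝔨 𝔥 t (htmul u (vacuum _)) =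
    htmul (htmul u (vacuum _)) (vacuum _) := by
  have h := gramUnitary_apply (fun p : 𝔥 × L2 𝔨 (Set.Ici 0) => htmul p.1 (expVec p.2))
    (fun p => htmul (htmul p.1 (expVec (restrictL2 (pastSet_subset t) p.2)))
      (expVec (restrictL2 (futureSet_subset t) p.2)))
    (fun p q => by
      simp only [inner_htmul, inner_expVec]
      rw [inner_eq_restrict_add t, Complex.exp_add, mul_assoc])
    (htmul_total (x := (id : 𝔥 → 𝔥)) isTotal_id expVec_total)
    -- The vacuum is the exponential vector of `0`, and both restrictions of `0` vanish.
    (splitTarget_total 𝔨 𝔥 t) (u, 0)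
  simp only [restrictL2_zero] at h
  exact h

/-- The vacuum factorises into the past and future vacua. This lets `P_t` be inserted next to the
vacuum vectors of an expectation. -/
theorem vacuumCond_vacuum (t : ℝ≥0) (u : 𝔥) :
    vacuumCond 𝔨 𝔥 t (htmul u (vacuum _)) = htmul u (vacuum _) := by
  rw [vacuumCond_eq, ContinuousLinearMap.comp_apply, adjoint_vacuumEmb_apply, splitUnitary_vacuum,
    adjoint_ket_vacuum_comp_ket]
  change (splitUnitary 𝔨 𝔥 t).symm (htmul (htmul u (vacuum _)) (vacuum _)) = _
  rw [← splitUnitary_vacuum, LinearIsometryEquiv.symm_apply_apply]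

theorem join_mul (t : ℝ≥0) (R S : HTensor (HTensor 𝔥 (NoisePast 𝔨 t)) (NoiseFuture 𝔨 t) →L[ℂ]
      HTensor (HTensor 𝔥 (NoisePast 𝔨 t)) (NoiseFuture 𝔨 t)) :
    join t (R * S) = join t R * join t S := by
  refine ContinuousLinearMap.ext fun ζ => ?_
  change (splitUnitary 𝔨 𝔥 t).symm (R (S (splitUnitary 𝔨 𝔥 t ζ))) =
    (splitUnitary 𝔨 𝔥 t).symm (R (splitUnitary 𝔨 𝔥 t ((splitUnitary 𝔨 𝔥 t).symm
      (S (splitUnitary 𝔨 𝔥 t ζ)))))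
  rw [LinearIsometryEquiv.apply_symm_apply]

theorem inner_join (t : ℝ≥0) (R : HTensor (HTensor 𝔥 (NoisePast 𝔨 t)) (NoiseFuture 𝔨 t) →L[ℂ]
      HTensor (HTensor 𝔥 (NoisePast 𝔨 t)) (NoiseFuture 𝔨 t)) (η ζ : HTensor 𝔥 (Noise 𝔨)) :
    inner ℂ η (join t R ζ) = inner ℂ (splitUnitary 𝔨 𝔥 t η) (R (splitUnitary 𝔨 𝔥 t ζ)) := by
  change inner ℂ η ((splitUnitary 𝔨 𝔥 t).symm (R (splitUnitary 𝔨 𝔥 t ζ))) = _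
  rw [← (splitUnitary 𝔨 𝔥 t).inner_map_map, LinearIsometryEquiv.apply_symm_apply]

theorem join_star (t : ℝ≥0) (R : HTensor (HTensor 𝔥 (NoisePast 𝔨 t)) (NoiseFuture 𝔨 t) →L[ℂ]
      HTensor (HTensor 𝔥 (NoisePast 𝔨 t)) (NoiseFuture 𝔨 t)) :
    join t (star R) = star (join t R) := by
  refine ContinuousLinearMap.ext fun ζ => ext_inner_left ℂ fun η => ?_
  rw [inner_join, ContinuousLinearMap.star_eq_adjoint, ContinuousLinearMap.star_eq_adjoint,
    ContinuousLinearMap.adjoint_inner_right, ContinuousLinearMap.adjoint_inner_right,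
    ← inner_conj_symm, ← inner_join, inner_conj_symm]

/-- Compression to the past is slicing at the future vacuum, and slices are precisely what is known
of an ampliation. -/
theorem vacuumEmb_conj_join (t : ℝ≥0)
    (R : HTensor (HTensor 𝔥 (NoisePast 𝔨 t)) (NoiseFuture 𝔨 t) →L[ℂ]
      HTensor (HTensor 𝔥 (NoisePast 𝔨 t)) (NoiseFuture 𝔨 t)) :
    (ContinuousLinearMap.adjoint (vacuumEmb t)).comp ((join t R).comp (vacuumEmb t)) =
      slice (vacuum _) (vacuum _) R := by
  refine ContinuousLinearMap.ext fun ξ => ?_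
  simp only [ContinuousLinearMap.comp_apply, adjoint_vacuumEmb_apply]
  change ContinuousLinearMap.adjoint _ (splitUnitary 𝔨 𝔥 t ((splitUnitary 𝔨 𝔥 t).symm
    (R (splitUnitary 𝔨 𝔥 t ((splitUnitary 𝔨 𝔥 t).symm (htmul ξ (vacuum _))))))) = _
  rw [LinearIsometryEquiv.apply_symm_apply, LinearIsometryEquiv.apply_symm_apply]
  rfl

theorem shiftFock_vacuum (t : ℝ≥0) : shiftFock 𝔨 t (vacuum _) = vacuum _ := by
  have h := gramUnitary_apply expVec (fun f => expVec (shiftL2 𝔨 t f))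
    (fun f g => by rw [inner_expVec, inner_expVec, LinearIsometryEquiv.inner_map_map])
    expVec_total
    (isTotal_iff.2 <| by
      have : Set.range (fun f => expVec (shiftL2 𝔨 t f)) =
          Set.range (expVec : L2 𝔨 (Set.Ici (t : ℝ)) → Fock _) :=
        (shiftL2 𝔨 t).surjective.range_comp expVec
      rw [this]
      exact isTotal_iff.1 expVec_total) 0
  rw [map_zero] at h
  exact h

theorem adjoint_opTensor_shiftFock_comp (t : ℝ≥0) :
    (ContinuousLinearMap.adjoint (opTensor (ContinuousLinearMap.id ℂ 𝔥) (shiftFock 𝔨 t))).comp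
      (opTensor (ContinuousLinearMap.id ℂ 𝔥) (shiftFock 𝔨 t)) = ContinuousLinearMap.id ℂ _ := by
  rw [opTensor_adjoint, opTensor_comp, shiftFock_adjoint_comp, ← opTensor_id]
  congr 1
  rw [ContinuousLinearMap.comp_id]
  exact star_one (𝔥 →L[ℂ] 𝔥)

theorem shiftOp_mul (t : ℝ≥0) (S T : HTensor 𝔥 (Noise 𝔨) →L[ℂ] HTensor 𝔥 (Noise 𝔨)) :
    shiftOp t (S * T) = shiftOp t S * shiftOp t T := by
  refine ContinuousLinearMap.ext fun ζ => ?_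
  have h : ∀ x, ContinuousLinearMap.adjoint (opTensor (ContinuousLinearMap.id ℂ 𝔥) (shiftFock 𝔨 t))
      (opTensor (ContinuousLinearMap.id ℂ 𝔥) (shiftFock 𝔨 t) x) = x := fun x =>
    congrArg (fun S => S x) (adjoint_opTensor_shiftFock_comp (𝔥 := 𝔥) (𝔨 := 𝔨) t)
  simp [shiftOp, h]

theorem star_conj {E F : Type*} [NormedAddCommGroup E] [InnerProductSpace ℂ E] [CompleteSpace E]
    [NormedAddCommGroup F] [InnerProductSpace ℂ F] [CompleteSpace F] (U : E →L[ℂ] F)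
    (T : E →L[ℂ] E) : star ((U.comp T).comp (ContinuousLinearMap.adjoint U)) =
      (U.comp (star T)).comp (ContinuousLinearMap.adjoint U) := by
  simp only [ContinuousLinearMap.star_eq_adjoint, ContinuousLinearMap.adjoint_comp,
    ContinuousLinearMap.adjoint_adjoint, ContinuousLinearMap.comp_assoc]

theorem shiftOp_star (t : ℝ≥0) (T : HTensor 𝔥 (Noise 𝔨) →L[ℂ] HTensor 𝔥 (Noise 𝔨)) :
    shiftOp t (star T) = star (shiftOp t T) := by
  exact (star_conj _ T).symm

/-- The second quantised shift carries vacuum to vacuum and is isometric, so its adjoint does the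
same in the other direction. -/
theorem slice_vacuum_shiftOp (t : ℝ≥0) (T : HTensor 𝔥 (Noise 𝔨) →L[ℂ] HTensor 𝔥 (Noise 𝔨)) :
    slice (vacuum _) (vacuum _) (shiftOp t T) = slice (vacuum _) (vacuum _) T := by
  have h : ∀ u : 𝔥, ContinuousLinearMap.adjoint
      (opTensor (ContinuousLinearMap.id ℂ 𝔥) (shiftFock 𝔨 t)) (htmul u (vacuum _)) =
      htmul u (vacuum _) := fun u => by
    have h1 := congrArg (fun S => S (htmul u (vacuum _)))
      (adjoint_opTensor_shiftFock_comp (𝔥 := 𝔥) (𝔨 := 𝔨) t)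
    simpa [shiftFock_vacuum] using h1
  refine ContinuousLinearMap.ext fun v => ext_inner_left ℂ fun u => ?_
  rw [inner_slice, inner_slice, shiftOp, ContinuousLinearMap.comp_apply,
    ContinuousLinearMap.comp_apply, h, ← ContinuousLinearMap.adjoint_inner_left, h]

end Vacuum

/-! ### Structure of the flow, and the Feynman–Kac semigroup. -/

section Flow

variable {𝔥 : Type u} [NormedAddCommGroup 𝔥] [InnerProductSpace ℂ 𝔥] [CompleteSpace 𝔥]
variable {𝔨 : Type v} [NormedAddCommGroup 𝔨] [InnerProductSpace ℂ 𝔨] [CompleteSpace 𝔨]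
variable {A : VonNeumannAlgebra 𝔥} (j : VacuumAdaptedFlow A 𝔨)

theorem pastMap_apply (t : ℝ≥0) (φ : A →ₗ[ℂ] noiseAlg A 𝔨) (a : A) : pastMap t φ a =
    (ContinuousLinearMap.adjoint (vacuumEmb t)).comp
      ((φ a : HTensor 𝔥 (Noise 𝔨) →L[ℂ] HTensor 𝔥 (Noise 𝔨)).comp (vacuumEmb t)) := rfl

namespace VacuumAdaptedFlow

theorem normal_past (t : ℝ≥0) : IsNormal (pastMap t (j.map t)) :=
  (j.normal t).conj (vacuumEmb t) (vacuumEmb t) (pastMap_apply t (j.map t))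

/-- Adaptedness yields some `R` with `j_t(a) = V R V*`; compressing by the isometry `V` identifies
`R` with `j_{t)}(a)`. -/
theorem map_eq (t : ℝ≥0) (a : A) :
    (j.map t a : HTensor 𝔥 (Noise 𝔨) →L[ℂ] HTensor 𝔥 (Noise 𝔨)) =
      (vacuumEmb t).comp
        ((pastMap t (j.map t) a).comp (ContinuousLinearMap.adjoint (vacuumEmb t))) := by
  obtain ⟨R, -, hR⟩ := j.adapted t a
  rw [join_opTensor_vacuumProj] at hR
  refine ContinuousLinearMap.ext fun ζ => ?_
  simp [pastMap_apply, hR, adjoint_vacuumEmb_vacuumEmb]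

/-- The unital `*`-homomorphism `j_{t)}`. -/
def pastHom (t : ℝ≥0) : A →⋆ₐ[ℂ] (HTensor 𝔥 (NoisePast 𝔨 t) →L[ℂ] HTensor 𝔥 (NoisePast 𝔨 t)) where
  toFun := pastMap t (j.map t)
  map_one' := j.past_one t
  map_mul' := j.past_mul t
  map_zero' := map_zero _
  map_add' := map_add _
  commutes' c := by
    rw [Algebra.algebraMap_eq_smul_one, Algebra.algebraMap_eq_smul_one, ← j.past_one t]
    exact map_smul (pastMap t (j.map t)) c 1
  map_star' := j.past_star t

/-- By `map_eq`, `j_t` is a `*`-homomorphism conjugated by `V*`, which is a contraction because `‖Ω‖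
= 1`. -/
theorem cbNormLE_map (t : ℝ≥0) : CBNormLE (incl (noiseAlg A 𝔨) ∘ₗ j.map t) 1 := by
  intro n a
  have hV : ‖ContinuousLinearMap.adjoint (vacuumEmb (𝔥 := 𝔥) (𝔨 := 𝔨) t)‖ ≤ 1 := by
    rw [LinearIsometryEquiv.norm_map]
    refine ContinuousLinearMap.opNorm_le_bound _ zero_le_one fun ξ => ?_
    change ‖(splitUnitary 𝔨 𝔥 t).symm (htmul ξ (vacuum _))‖ ≤ 1 * ‖ξ‖
    rw [LinearIsometryEquiv.norm_map, norm_htmul, norm_vacuum, mul_comm]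
  have h1 := norm_matOp_conj_le (ContinuousLinearMap.adjoint (vacuumEmb (𝔥 := 𝔥) (𝔨 := 𝔨) t))
    (ContinuousLinearMap.adjoint (vacuumEmb t)) fun i k => pastMap t (j.map t) (a i k)
  simp only [ContinuousLinearMap.adjoint_adjoint, ← map_eq] at h1
  rw [one_mul]
  refine h1.trans (le_trans ?_ (norm_matOp_starHom_le A (j.pastHom t) a))
  exact mul_le_of_le_one_left (norm_nonneg _) (mul_le_one₀ hV (norm_nonneg _) hV)

theorem completelyPositive_map (t : ℝ≥0) :
    IsCompletelyPositive (incl (noiseAlg A 𝔨) ∘ₗ j.map t) := by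
  intro n a ha
  have h1 := isPositive_matOp_conj
    (ContinuousLinearMap.adjoint (vacuumEmb (𝔥 := 𝔥) (𝔨 := 𝔨) t))
    (isPositive_matOp_starHom A (j.pastHom t) a ha)
  rw [ContinuousLinearMap.adjoint_adjoint] at h1
  have h2 : ∀ i k, (vacuumEmb t).comp ((j.pastHom t (a i k)).comp
      (ContinuousLinearMap.adjoint (vacuumEmb t))) = (incl (noiseAlg A 𝔨) ∘ₗ j.map t) (a i k) :=
    fun i k => (j.map_eq t (a i k)).symm
  simpa only [h2] using h1

/-- Shift, ampliation and identification of the tensor factors are each multiplicative; for the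
ampliation this needs `j_{t)}` to be normal as well as multiplicative. -/
theorem ext_mul (t : ℝ≥0) (S T : noiseAlg A 𝔨) : j.ext t (S * T) = j.ext t S * j.ext t T := by
  have h : shiftMap A t (S * T) = shiftMap A t S * shiftMap A t T :=
    Subtype.ext (shiftOp_mul t _ _)
  rw [ext, ext, ext, cocycleExt, cocycleExt, cocycleExt, h, ← join_mul]
  exact congrArg (join t) (ampliation_mul _ (j.normal_past t) (j.past_mul t) _ _)

theorem ext_star (t : ℝ≥0) (T : noiseAlg A 𝔨) : j.ext t (star T) = star (j.ext t T) := by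
  have h : shiftMap A t (star T) = star (shiftMap A t T) := Subtype.ext (shiftOp_star t _)
  rw [ext, ext, cocycleExt, cocycleExt, h, ← join_star]
  exact congrArg (join t) (ampliation_star _ (j.past_star t) _)

/-- Compressing `J_t(T)` to the past takes the future vacuum slice of an ampliation, that is,
`j_{t)}` of the vacuum slice of the shifted `T`. The shift preserves the vacuum, so that slice is
`𝔼[T]`, and conjugating back by `V` turns `j_{t)}` into `j_t`. -/
theorem vacuumCond_ext (t : ℝ≥0) (T : noiseAlg A 𝔨) :
    vacuumCond 𝔨 𝔥 t * j.ext t T * vacuumCond 𝔨 𝔥 t = j.map t (vacuumExp A 𝔨 T) := by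
  have h : (ContinuousLinearMap.adjoint (vacuumEmb t)).comp ((j.ext t T).comp (vacuumEmb t)) =
      pastMap t (j.map t) (vacuumExp A 𝔨 T) := by
    refine (vacuumEmb_conj_join t _).trans ((slice_ampliation (φ := pastMap t (j.map t))
      ((j.completelyBounded t).compress (vacuumEmb t)) (shiftMap A t T) _ _).trans ?_)
    exact congrArg (pastMap t (j.map t)) (Subtype.ext (slice_vacuum_shiftOp t _))
  rw [map_eq, ← h, vacuumCond_eq]
  refine ContinuousLinearMap.ext fun ζ => ?_
  simp only [mul_apply_eq_comp, ContinuousLinearMap.comp_apply]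

end VacuumAdaptedFlow

variable {j} {M N : ℝ≥0 → noiseAlg A 𝔨}

/-- Absorbing the vacuum vectors into the multipliers exhibits the map as a two-sided compression of
`j_t`, from which normality, the norm bound and positivity are read off. -/
theorem coe_feynmanKac (t : ℝ≥0) (a : A) : (feynmanKac j M N t a : 𝔥 →L[ℂ] 𝔥) =
    (ContinuousLinearMap.adjoint ((M t : HTensor 𝔥 (Noise 𝔨) →L[ℂ] _).comp
      (ket 𝔥 (vacuum _)))).comp ((j.map t a : HTensor 𝔥 (Noise 𝔨) →L[ℂ] HTensor 𝔥 (Noise 𝔨)).comp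
        ((N t : HTensor 𝔥 (Noise 𝔨) →L[ℂ] _).comp (ket 𝔥 (vacuum _)))) := by
  rw [ContinuousLinearMap.adjoint_comp]
  rfl

theorem coe_feynmanKac_eq_slice (t : ℝ≥0) (a : A) : (feynmanKac j M N t a : 𝔥 →L[ℂ] 𝔥) =
    slice (vacuum _) (vacuum _) (star (M t : HTensor 𝔥 (Noise 𝔨) →L[ℂ] HTensor 𝔥 (Noise 𝔨)) *
      (j.map t a : HTensor 𝔥 (Noise 𝔨) →L[ℂ] HTensor 𝔥 (Noise 𝔨)) *
      (N t : HTensor 𝔥 (Noise 𝔨) →L[ℂ] HTensor 𝔥 (Noise 𝔨))) := rfl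

theorem feynmanKac_zero (hM : M 0 = 1) (hN : N 0 = 1) :
    feynmanKac j M N 0 = LinearMap.id := by
  refine LinearMap.ext fun a => Subtype.ext ?_
  rw [coe_feynmanKac_eq_slice, hM, hN, OneMemClass.coe_one, star_one, one_mul, mul_one, j.initial,
    slice_opTensor, vacuumProj, InnerProductSpace.rankOne_apply, inner_vacuum, one_smul,
    inner_vacuum, one_smul, LinearMap.id_apply]

/-- The two copies of `P_t` commute outwards past `X*` and `Y` and are then absorbed by the vacuum
vectors, which they fix. -/
theorem slice_vacuum_conj {X Y : HTensor 𝔥 (Noise 𝔨) →L[ℂ] HTensor 𝔥 (Noise 𝔨)} {t : ℝ≥0}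
    (hX : X * vacuumCond 𝔨 𝔥 t = vacuumCond 𝔨 𝔥 t * X)
    (hY : Y * vacuumCond 𝔨 𝔥 t = vacuumCond 𝔨 𝔥 t * Y)
    (T : HTensor 𝔥 (Noise 𝔨) →L[ℂ] HTensor 𝔥 (Noise 𝔨)) :
    slice (vacuum _) (vacuum _) (star X * T * Y) = slice (vacuum _) (vacuum _)
      (star X * (vacuumCond 𝔨 𝔥 t * T * vacuumCond 𝔨 𝔥 t) * Y) := by
  set P := vacuumCond 𝔨 𝔥 t with hP
  have hX' : P * star X = star X * P := by
    have := congrArg star hX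
    rwa [star_mul, star_mul, star_vacuumCond] at this
  have h : star X * (P * T * P) * Y = P * (star X * T * Y) * P := by
    calc star X * (P * T * P) * Y = (star X * P) * T * (P * Y) := by simp only [mul_assoc]
      _ = _ := by rw [← hX', ← hY]; simp only [mul_assoc]
  rw [h]
  refine ContinuousLinearMap.ext fun v => ext_inner_left ℂ fun u => ?_
  have hP' : ∀ η ζ, inner ℂ η (P ζ) = inner ℂ (P η) ζ := fun η ζ => by
    rw [← ContinuousLinearMap.adjoint_inner_left, ← ContinuousLinearMap.star_eq_adjoint,
      hP, star_vacuumCond]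
  rw [inner_slice, inner_slice, mul_apply_eq_comp (P * _) P, mul_apply_eq_comp P, hP', hP,
    vacuumCond_vacuum, vacuumCond_vacuum]

theorem feynmanKac_add (hM : IsMultiplier j M) (hN : IsMultiplier j N) (s t : ℝ≥0) :
    feynmanKac j M N (s + t) = feynmanKac j M N s ∘ₗ feynmanKac j M N t := by
  refine LinearMap.ext fun a => Subtype.ext ?_
  have hj : (j.map (s + t) a : HTensor 𝔥 (Noise 𝔨) →L[ℂ] HTensor 𝔥 (Noise 𝔨)) =
      j.ext s (j.map t a) := j.cocycle s t a
  -- The three cocycle identities together: the factors `J_s(M_t)*`, `J_s(j_t(a))` and `J_s(N_t)`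
  -- are adjacent, and merge because `J_s` is multiplicative and `*`-preserving.
  have h : star (M (s + t) : HTensor 𝔥 (Noise 𝔨) →L[ℂ] HTensor 𝔥 (Noise 𝔨)) *
      j.map (s + t) a * N (s + t) =
      star (M s : HTensor 𝔥 (Noise 𝔨) →L[ℂ] HTensor 𝔥 (Noise 𝔨)) *
        j.ext s (star (M t) * j.map t a * N t) * N s := by
    rw [hM.cocycle, hN.cocycle, hj, j.ext_mul, j.ext_mul, j.ext_star, star_mul]
    simp only [mul_assoc]
  rw [LinearMap.comp_apply, coe_feynmanKac_eq_slice, coe_feynmanKac_eq_slice, h,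
    slice_vacuum_conj (hM.commute s) (hN.commute s), j.vacuumCond_ext]
  rfl

/-- Every orbit is bounded on a compact neighbourhood, so the uniform boundedness principle bounds
the operators there. -/
theorem exists_eventually_norm_le {X : Type*} [TopologicalSpace X] [WeaklyLocallyCompactSpace X]
    {E F : Type*} [NormedAddCommGroup E] [NormedSpace ℂ E] [CompleteSpace E]
    [NormedAddCommGroup F] [NormedSpace ℂ F] {f : X → E →L[ℂ] F}
    (hf : ∀ ξ, Continuous fun t => f t ξ) (x : X) : ∃ C, ∀ᶠ t in 𝓝 x, ‖f t‖ ≤ C := by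
  obtain ⟨s, hs, hx⟩ := exists_compact_mem_nhds x
  obtain ⟨C, hC⟩ := banach_steinhaus (g := fun t : s => f t) fun ξ => by
    obtain ⟨C, hC⟩ := hs.exists_bound_of_continuousOn (hf ξ).continuousOn
    exact ⟨C, fun t => hC t t.2⟩
  exact ⟨C, by filter_upwards [hx] with t ht using hC ⟨t, ht⟩⟩

/-- The middle operators converge only in one matrix element; their uniform bound together with norm
convergence of the outer vectors makes the error vanish. -/
theorem tendsto_inner_apply_of_bounded {α E F : Type*} [NormedAddCommGroup E]
    [InnerProductSpace ℂ E] [NormedAddCommGroup F] [InnerProductSpace ℂ F] {l : Filter α}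
    {T : α → E →L[ℂ] F} {T₀ : E →L[ℂ] F} {η : α → F} {η₀ : F} {ζ : α → E} {ζ₀ : E} {C : ℝ}
    (hC : ∀ i, ‖T i‖ ≤ C)
    (hT : Tendsto (fun i => inner ℂ η₀ (T i ζ₀)) l (𝓝 (inner ℂ η₀ (T₀ ζ₀))))
    (hη : Tendsto η l (𝓝 η₀)) (hζ : Tendsto ζ l (𝓝 ζ₀)) :
    Tendsto (fun i => inner ℂ (η i) (T i (ζ i))) l (𝓝 (inner ℂ η₀ (T₀ ζ₀))) := by
  have h : Tendsto (fun i => inner ℂ (η i) (T i (ζ i)) - inner ℂ η₀ (T i ζ₀)) l (𝓝 0) := by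
    have hη' := tendsto_iff_norm_sub_tendsto_zero.1 hη
    have hζ' := tendsto_iff_norm_sub_tendsto_zero.1 hζ
    have hb : Tendsto (fun i => ‖η i‖ * (C * ‖ζ i - ζ₀‖) + ‖η i - η₀‖ * (C * ‖ζ₀‖)) l (𝓝 0) := by
      have := (hη.norm.mul (hζ'.const_mul C)).add (hη'.mul_const (C * ‖ζ₀‖))
      simpa using this
    refine squeeze_zero_norm (fun i => ?_) hb
    have e : inner ℂ (η i) (T i (ζ i)) - inner ℂ η₀ (T i ζ₀) =
        inner ℂ (η i) (T i (ζ i - ζ₀)) + inner ℂ (η i - η₀) (T i ζ₀) := by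
      simp only [map_sub, inner_sub_right, inner_sub_left]
      ring
    rw [e]
    refine (norm_add_le _ _).trans (add_le_add ?_ ?_)
    · exact (norm_inner_le_norm _ _).trans (by gcongr; exact (T i).le_of_opNorm_le (hC i) _)
    · exact (norm_inner_le_norm _ _).trans (by gcongr; exact (T i).le_of_opNorm_le (hC i) _)
  simpa using h.add hT

theorem continuous_feynmanKac (hM : IsMultiplier j M) (hN : IsMultiplier j N) (a : A) :
    @Continuous ℝ≥0 (𝔥 →L[ℂ] 𝔥) _ (ultraweak 𝔥)
      fun t => (feynmanKac j M N t a : 𝔥 →L[ℂ] 𝔥) := by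
  refine (@continuous_iff_continuousAt _ _ _ (ultraweak 𝔥) _).2 fun t => ?_
  obtain ⟨C, hC⟩ := exists_eventually_norm_le hM.continuous t
  obtain ⟨D, hD⟩ := exists_eventually_norm_le hN.continuous t
  have hj : ∀ r, ‖(j.map r a : HTensor 𝔥 (Noise 𝔨) →L[ℂ] HTensor 𝔥 (Noise 𝔨))‖ ≤
      1 * ‖(a : 𝔥 →L[ℂ] 𝔥)‖ := fun r => (j.cbNormLE_map r).norm_le zero_le_one a
  -- Moving `M_r*` to the left slot leaves `M_r` acting on a fixed vector, so strong continuity of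
  -- `r ↦ M_r` suffices and none is needed for the adjoints.
  have h1 : ∀ (r : ℝ≥0) (u v : 𝔥), inner ℂ u ((feynmanKac j M N r a : 𝔥 →L[ℂ] 𝔥) v) =
      inner ℂ ((M r : HTensor 𝔥 (Noise 𝔨) →L[ℂ] HTensor 𝔥 (Noise 𝔨)) (htmul u (vacuum _)))
        ((j.map r a : HTensor 𝔥 (Noise 𝔨) →L[ℂ] HTensor 𝔥 (Noise 𝔨))
          ((N r : HTensor 𝔥 (Noise 𝔨) →L[ℂ] HTensor 𝔥 (Noise 𝔨)) (htmul v (vacuum _)))) := by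
    intro r u v
    rw [coe_feynmanKac, ContinuousLinearMap.comp_apply, ContinuousLinearMap.adjoint_inner_right]
    rfl
  refine tendsto_ultraweak_of_bounded
    (C := C * (1 * ‖(a : 𝔥 →L[ℂ] 𝔥)‖) * D * ‖vacuum (L2 𝔨 (Set.Ici 0))‖ *
      ‖vacuum (L2 𝔨 (Set.Ici 0))‖) ?_ fun u v => ?_
  · filter_upwards [hC, hD] with r hr hr'
    refine (norm_slice_le (vacuum _) (vacuum _) _).trans ?_
    have hC0 : 0 ≤ C := (norm_nonneg _).trans hr
    gcongr
    refine (norm_mul_le _ _).trans (mul_le_mul ((norm_mul_le _ _).trans ?_) hr' (norm_nonneg _)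
      (by positivity))
    refine mul_le_mul ?_ (hj r) (norm_nonneg _) hC0
    exact (norm_star (M r : HTensor 𝔥 (Noise 𝔨) →L[ℂ] HTensor 𝔥 (Noise 𝔨))).trans_le hr
  · simp only [h1]
    refine tendsto_inner_apply_of_bounded hj ?_ ((hM.continuous _).tendsto t)
      ((hN.continuous _).tendsto t)
    exact Tendsto.inner_of_ultraweak
      (@Continuous.tendsto _ _ _ (ultraweak (HTensor 𝔥 (Noise 𝔨))) _ (j.continuous a) t) _ _

/-- `j_t` is completely contractive and `E_Ω` is a contraction, so only the norms of the multipliers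
contribute. The explicit constant gives complete boundedness and complete contractivity at once. -/
theorem cbNormLE_feynmanKac (M N : ℝ≥0 → noiseAlg A 𝔨) (t : ℝ≥0) :
    CBNormLE (incl A ∘ₗ feynmanKac j M N t)
      (‖(M t : HTensor 𝔥 (Noise 𝔨) →L[ℂ] HTensor 𝔥 (Noise 𝔨))‖ *
        ‖(N t : HTensor 𝔥 (Noise 𝔨) →L[ℂ] HTensor 𝔥 (Noise 𝔨))‖) := by
  intro n a
  have hE : ‖ket 𝔥 (vacuum (L2 𝔨 (Set.Ici 0)))‖ ≤ 1 := by
    refine (norm_ket_le _).trans_eq (norm_vacuum _)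
  have hX : ∀ X : HTensor 𝔥 (Noise 𝔨) →L[ℂ] HTensor 𝔥 (Noise 𝔨),
      ‖X.comp (ket 𝔥 (vacuum (L2 𝔨 (Set.Ici 0))))‖ ≤ ‖X‖ := fun X =>
    (X.opNorm_comp_le _).trans (mul_le_of_le_one_right (norm_nonneg _) hE)
  simp only [LinearMap.comp_apply, incl_apply, coe_feynmanKac]
  refine (norm_matOp_conj_le _ _ _).trans ?_
  have h1 := j.cbNormLE_map t n a
  rw [one_mul] at h1
  exact mul_le_mul (mul_le_mul (hX _) (hX _) (norm_nonneg _) (norm_nonneg _)) h1 (norm_nonneg _)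
    (by positivity)

theorem completelyPositive_feynmanKac (M : ℝ≥0 → noiseAlg A 𝔨) (t : ℝ≥0) :
    IsCompletelyPositive (incl A ∘ₗ feynmanKac j M M t) := by
  intro n a ha
  simp only [LinearMap.comp_apply, incl_apply, coe_feynmanKac]
  exact isPositive_matOp_conj _ (j.completelyPositive_map t n a ha)

end Flow
end QStoch
end

theorem theorem2p6
    {𝔥 : Type*} [NormedAddCommGroup 𝔥] [InnerProductSpace ℂ 𝔥] [CompleteSpace 𝔥]
    {𝔨 : Type*} [NormedAddCommGroup 𝔨] [InnerProductSpace ℂ 𝔨] [CompleteSpace 𝔨]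
    (A : VonNeumannAlgebra 𝔥) (j : QStoch.VacuumAdaptedFlow A 𝔨)
    (M N : ℝ≥0 → QStoch.noiseAlg A 𝔨)
    (hM : QStoch.IsMultiplier j M) (hN : QStoch.IsMultiplier j N) :
    -- normality and complete boundedness
    (∀ t, QStoch.IsNormal (QStoch.incl A ∘ₗ QStoch.feynmanKac j M N t)) ∧
    (∀ t, QStoch.IsCompletelyBounded (QStoch.incl A ∘ₗ QStoch.feynmanKac j M N t)) ∧
    -- ultraweak continuity in the time variable
    (∀ a : A, @Continuous ℝ≥0 (𝔥 →L[ℂ] 𝔥) _ (QStoch.ultraweak 𝔥)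
      fun t => (QStoch.feynmanKac j M N t a : 𝔥 →L[ℂ] 𝔥)) ∧
    -- the semigroup property
    QStoch.feynmanKac j M N 0 = LinearMap.id ∧
    (∀ s t, QStoch.feynmanKac j M N (s + t) =
      QStoch.feynmanKac j M N s ∘ₗ QStoch.feynmanKac j M N t) ∧
    -- complete contractivity
    ((∀ t, ‖(M t : QStoch.HTensor 𝔥 (QStoch.Noise 𝔨) →L[ℂ] QStoch.HTensor 𝔥 (QStoch.Noise 𝔨))‖ ≤ 1) →
      (∀ t, ‖(N t : QStoch.HTensor 𝔥 (QStoch.Noise 𝔨) →L[ℂ] QStoch.HTensor 𝔥 (QStoch.Noise 𝔨))‖ ≤ 1) →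
      ∀ t, QStoch.IsCompletelyContractive (QStoch.incl A ∘ₗ QStoch.feynmanKac j M N t)) ∧
    -- complete positivity
    (M = N → ∀ t, QStoch.IsCompletelyPositive (QStoch.incl A ∘ₗ QStoch.feynmanKac j M N t)) := by
  refine ⟨fun t => (j.normal t).conj _ _ (QStoch.coe_feynmanKac t),
    fun t => ⟨_, QStoch.cbNormLE_feynmanKac M N t⟩, QStoch.continuous_feynmanKac hM hN,
    QStoch.feynmanKac_zero hM.zero hN.zero, QStoch.feynmanKac_add hM hN,
    fun h1 h2 t n a => ?_, ?_⟩
  · refine (QStoch.cbNormLE_feynmanKac M N t n a).trans ?_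
    gcongr
    exact mul_le_one₀ (h1 t) (norm_nonneg _) (h2 t)
  · rintro rfl t
    exact QStoch.completelyPositive_feynmanKac M t
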